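/- Let $\ell$ and $p$ be distinct primes and let $T_d$ denote the monic Chebyshev polynomial, $T_d(z+z^{-1})=z^d+z^{-d}$; write $T_\ell^n$ for the $n$-fold iterate of $T_\ell$. Let $t\in\mathbb Z$ be such that $T_\ell^n(x)-t$ is irreducible over $\mathbb Z$ for every $n\ge 1$. Choose elements $\theta_0=t,\theta_1,\theta_2,\dots$ of a field of characteristic $0$ with $T_\ell(\theta_{n+1})=\theta_n$, and put $K_n=\mathbb Q(\theta_n)$ and $K_\infty=\bigcup_n K_n$ (so $K_0=\mathbb Q$). Let $\mu$ be the order of $p$ in $(\mathbb Z/\ell\mathbb Z)^\times/(\pm1)$, let $D_1$ and $D_2$ be the elements of $\{p^\mu-1,p^\mu+1\}$ with the larger and the smaller $\ell$-adic valuation respectively, and let $v=\nu_\ell(D_1)$. Let $\bar t\in\mathbb F_p$ be the reduction of $t$ and let $\rho\ge 0$ be its preperiod under $T_\ell:\mathbb F_p\to\mathbb F_p$, i.e. the least $\rho$ such that $T_\ell^{\rho+\pi}(\bar t)=T_\ell^{\rho}(\bar t)$ for some $\pi\ge1$. An element $a\in\mathbb F_p$ corresponds to the integer $d$ if $a=\alpha+\alpha^{-1}$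 with $\alpha\in\mathbb F_{p^2}^\times$ of order $d$; all elements of a cycle of $T_\ell$ on $\mathbb F_p$ correspond to the same $d$, and $\bar t$ is connected to that cycle if its forward orbit under $T_\ell$ enters it. Suppose $p\nmid \ell(4-t^2)$. **Case 1: $\ell$ is odd.** 1. If $\rho>0$, then $\rho\le v$, $p$ splits completely in $K_1,\dots,K_{v-\rho}$, and $p$ is totally inert afterwards: every prime of $K_{v-\rho}$ above $p$ remains prime in $K_n$ for all $n\ge v-\rho$. 2. If $\rho=0$, then for every $n$ there is at least one prime of $K_n$ above $p$ of degree $1$, and there is exactly one prime of $K_\infty$ above $p$ of degree $1$ (that is, with residue field $\mathbb F_p$). **Case 2: $\ell=2$.** 1. If $\rho>0$ and $\bar t$ is connected to a cycle corresponding to a divisor $d$ of $D_1$, then $\rho\le v$, $p$ splits completely in $K_1,\dots,K_{v-\rho}$, and every prime of $K_{v-\rho}$ above $p$ remains prime in $K_n$ for all $n\ge v-\rho$. 2. If $\rho>0$ and $\bar t$ is connected to a cycle corresponding to a divisor $d\ne1$ of $D_2$, then $\rho\le v$, $p$ is inert in $K_1$, the prime of $K_1$ above $p$ splits completely in $K_2,\dots,K_{v-\rho+1}$,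 and every prime of $K_{v-\rho+1}$ above $p$ remains prime in $K_n$ for all $n\ge v-\rho+1$. 3. If $\rho=0$, then for every $n$ there is at least one prime of $K_n$ above $p$ of degree $1$, and there is exactly one prime of $K_\infty$ above $p$ of degree $1$. -/

import Mathlib

open NumberField

noncomputable section

namespace ChebTower

/-- The monic Chebyshev polynomial `T_d`, with `T_d (z + z⁻¹) = z ^ d + (z⁻¹) ^ d`. -/
def chebPoly (d : ℕ) (R : Type*) [CommRing R] : Polynomial R :=
  Polynomial.Chebyshev.C R (d : ℤ)

/-- The `n`-th iterate of `T_d` under composition, as a polynomial; the `0`-th iterate is `x`. -/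
def chebIter (d : ℕ) (R : Type*) [CommRing R] (n : ℕ) : Polynomial R :=
  (chebPoly d R).comp^[n] Polynomial.X

/-- The self-map `a ↦ T_d(a)` of a commutative ring. -/
def chebMap (d : ℕ) (R : Type*) [CommRing R] (a : R) : R :=
  (chebPoly d R).eval a

/-- The preperiod of `a` under `φ`: the least `ρ` with `φ^{ρ+π}(a) = φ^ρ(a)` for some `π ≥ 1`.
Such a `ρ` always exists on a finite set. -/
def preperiod {S : Type*} (φ : S → S) (a : S) : ℕ :=
  sInf {r : ℕ | ∃ π : ℕ, 1 ≤ π ∧ φ^[r + π] a = φ^[r] a}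

/-- The order of `p` in `(ℤ/ℓℤ)ˣ / (±1)`. -/
def mu (ℓ p : ℕ) (h : p.Coprime ℓ) : ℕ :=
  orderOf (QuotientGroup.mk (ZMod.unitOfCoprime p h) :
    (ZMod ℓ)ˣ ⧸ Subgroup.zpowers (-1 : (ZMod ℓ)ˣ))

/-- The one of `p ^ μ - 1`, `p ^ μ + 1` with the larger `ℓ`-adic valuation. -/
def D₁ (ℓ p : ℕ) (h : p.Coprime ℓ) : ℕ :=
  if padicValNat ℓ (p ^ mu ℓ p h - 1) < padicValNat ℓ (p ^ mu ℓ p h + 1)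
  then p ^ mu ℓ p h + 1 else p ^ mu ℓ p h - 1

/-- The one of `p ^ μ - 1`, `p ^ μ + 1` with the smaller `ℓ`-adic valuation. -/
def D₂ (ℓ p : ℕ) (h : p.Coprime ℓ) : ℕ :=
  if padicValNat ℓ (p ^ mu ℓ p h - 1) < padicValNat ℓ (p ^ mu ℓ p h + 1)
  then p ^ mu ℓ p h - 1 else p ^ mu ℓ p h + 1

/-- The element `a` of `𝔽_p` corresponds to the number `d`: one has `a = α + α⁻¹` for some
`α ∈ 𝔽_{p²}ˣ` of order `d`. -/
def CorrespondsTo (p : ℕ) [Fact p.Prime] (a : ZMod p) (d : ℕ) : Prop :=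
  ∃ α : (GaloisField p 2)ˣ,
    algebraMap (ZMod p) (GaloisField p 2) a = (α : GaloisField p 2) + (α⁻¹ : (GaloisField p 2)ˣ) ∧
      orderOf α = d

/-- In the graph of `T_ℓ` over `𝔽_p`, the vertex `a` is connected to a cycle whose vertices
correspond to the number `d`: the orbit of `a` runs into a periodic point corresponding to `d`. -/
def ConnectedToCycle (ℓ p : ℕ) [Fact p.Prime] (a : ZMod p) (d : ℕ) : Prop :=
  ∃ k : ℕ, (chebMap ℓ (ZMod p))^[k] a ∈ Function.periodicPts (chebMap ℓ (ZMod p)) ∧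
    CorrespondsTo p ((chebMap ℓ (ZMod p))^[k] a) d

section Fields

variable {L : Type*} [Field L] [CharZero L]

/-- `θ` is a compatible sequence of preimages of `t`: `θ 0 = t` and `T_ℓ (θ (n+1)) = θ n`. -/
def IsCompatible (ℓ : ℕ) (t : ℤ) (θ : ℕ → L) : Prop :=
  θ 0 = (t : L) ∧ ∀ n : ℕ, chebMap ℓ L (θ (n + 1)) = θ n

/-- The field `K_n = ℚ(θ_n)`. -/
def level (θ : ℕ → L) (n : ℕ) : IntermediateField ℚ L :=
  IntermediateField.adjoin ℚ {θ n}

/-- The infinite level `K_∞`, the compositum (union) of all the `K_n`. -/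
def levelInfty (θ : ℕ → L) : IntermediateField ℚ L :=
  ⨆ n, level θ n

/-- The ideal `J` is a product of exactly `k` pairwise distinct prime ideals. -/
def IsProdDistinctPrimes {R : Type*} [CommRing R] (J : Ideal R) (k : ℕ) : Prop :=
  ∃ S : Finset (Ideal R), S.card = k ∧ (∀ P ∈ S, P.IsPrime) ∧ J = ∏ P ∈ S, P

/-- `p` splits completely in `F`: `p 𝓞_F` is a product of `[F : ℚ]` distinct primes. -/
def SplitsCompletely (p : ℕ) (F : IntermediateField ℚ L) : Prop :=
  IsProdDistinctPrimes (Ideal.span {(p : 𝓞 F)}) (Module.finrank ℚ F)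

/-- `p` is inert in `F`: `p 𝓞_F` is a prime ideal. -/
def Inert (p : ℕ) (F : IntermediateField ℚ L) : Prop :=
  (Ideal.span {(p : 𝓞 F)}).IsPrime

/-- The inclusion of the rings of integers of `E ≤ F`. -/
def ringInclusion {E F : IntermediateField ℚ L} (h : E ≤ F) : 𝓞 E →+* 𝓞 F :=
  RingOfIntegers.mapRingHom (IntermediateField.inclusion h).toRingHom

/-- `F / E` is an extension in which every prime of `E` above `p` splits completely. -/
def SplitsCompletelyAbove (p : ℕ) (E F : IntermediateField ℚ L) : Prop :=
  ∃ h : E ≤ F, ∀ P : Ideal (𝓞 E), P.IsPrime → (p : 𝓞 E) ∈ P →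
    IsProdDistinctPrimes (P.map (ringInclusion h)) (IntermediateField.relfinrank E F)

/-- `F / E` is an extension in which every prime of `E` above `p` stays prime. -/
def InertAbove (p : ℕ) (E F : IntermediateField ℚ L) : Prop :=
  ∃ h : E ≤ F, ∀ P : Ideal (𝓞 E), P.IsPrime → (p : 𝓞 E) ∈ P →
    (P.map (ringInclusion h)).IsPrime

/-- `P` is a prime of `F` above `p` of (residue) degree `1`. -/
def IsDegreeOnePrime (p : ℕ) (F : IntermediateField ℚ L) (P : Ideal (𝓞 F)) : Prop :=
  P.IsPrime ∧ P.LiesOver (Ideal.span {(p : ℤ)}) ∧ P.inertiaDeg ℤ = 1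

end Fields

end ChebTower

end

/-! Writing `a = α + α⁻¹` turns `T_ℓ` into `α ↦ α ^ ℓ`. The derivative `f'` of `f = T_ℓⁿ - t`
satisfies `(4 - θ_n²) f'(θ_n)² = ℓ²ⁿ (4 - t²)`, whose right-hand side is prime to `p`, so `𝓞 K_n` is
generated by `θ_n` up to integers prime to `p`. Hence the homomorphisms from `𝓞 K_n` to an algebraic
closure of `𝔽_p` correspond to the preimages of `t` under `T_ℓⁿ`, and the primes of `K_n` above `p`
to the Frobenius orbits of these preimages. Frobenius is `α ↦ α ^ p`, so the length of an orbit is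
the order of `p`, up to sign, modulo the order of `α`; lifting the exponent tells how it grows with
`n`. -/

noncomputable section

namespace ChebTower

open Polynomial

section Chebyshev

variable {R : Type*} [CommRing R]

theorem chebPoly_pow (d n : ℕ) : chebPoly (d ^ n) R = chebIter d R n := by
  induction n with
  | zero => simp [chebPoly, chebIter]
  | succ n ih =>
    rw [chebIter, Function.iterate_succ_apply', ← chebIter, ← ih, chebPoly, chebPoly, chebPoly,
      ← Chebyshev.C_mul, pow_succ', Nat.cast_mul]

theorem chebMap_pow (d n : ℕ) : chebMap (d ^ n) R = (chebMap d R)^[n] := by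
  funext a
  rw [chebMap, chebPoly_pow, chebIter, iterate_comp_eval, eval_X]
  rfl

variable (R) in
theorem aeval_chebPoly {A : Type*} [CommRing A] [Algebra R A] (n : ℕ) (x : A) :
    aeval x (chebPoly n R) = chebMap n A x :=
  Chebyshev.aeval_C x n

theorem map_chebMap {S : Type*} [CommRing S] (φ : R →+* S) (n : ℕ) (a : R) :
    φ (chebMap n R a) = chebMap n S (φ a) := by
  rw [chebMap, chebMap, chebPoly, chebPoly, ← Chebyshev.map_C φ, eval_map_apply]

variable (R) in
theorem isMonicOfDegree_chebPoly [Nontrivial R] {n : ℕ} (hn : n ≠ 0) :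
    IsMonicOfDegree (chebPoly n R) n := by
  suffices ∀ n, IsMonicOfDegree (chebPoly (n + 1) R) (n + 1) by
    simpa only [Nat.sub_add_cancel (Nat.pos_of_ne_zero hn)] using this (n - 1)
  clear hn n
  intro n
  induction n using Nat.twoStepInduction with
  | zero => simpa [chebPoly] using isMonicOfDegree_X R
  | one =>
    have h2 : chebPoly (1 + 1) R = X ^ 2 - 2 := Chebyshev.C_two R
    rw [h2]
    exact (isMonicOfDegree_X_pow R 2).sub (by simp)
  | more n ih₁ ih₂ =>
    have hrec : chebPoly (n + 2 + 1) R = X * chebPoly (n + 1 + 1) R - chebPoly (n + 1) R := by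
      have := Chebyshev.C_add_two R (n + 1)
      rwa [add_right_comm] at this
    rw [hrec, add_comm (n + 2) 1]
    exact ((isMonicOfDegree_X R).mul ih₂).sub (by rw [ih₁.natDegree_eq]; omega)

variable (R) in
theorem derivative_chebPoly (n : ℕ) :
    derivative (chebPoly n R) = n * Chebyshev.S R ((n : ℤ) - 1) := by
  induction n using Nat.twoStepInduction with
  | zero => simp [chebPoly]
  | one => simp [chebPoly]
  | more n ih₁ ih₂ =>
    have hS := Chebyshev.S_eq_X_mul_S_add_C R (n : ℤ)
    have hS' := Chebyshev.S_add_one R (n : ℤ)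
    simp only [chebPoly] at ih₁ ih₂ ⊢
    push_cast at ih₁ ih₂ ⊢
    rw [Chebyshev.C_add_two, derivative_sub, derivative_mul, derivative_X, ih₁, ih₂,
      show (n : ℤ) + 2 - 1 = n + 1 by ring, add_sub_cancel_right]
    linear_combination (-1 : R[X]) * hS - (n : R[X]) * hS'

variable (R) in
theorem chebPoly_sq_sub_four (n : ℕ) :
    chebPoly n R ^ 2 - 4 = (X ^ 2 - 4) * Chebyshev.S R ((n : ℤ) - 1) ^ 2 := by
  have h := Chebyshev.S_sq_add_S_sq R ((n : ℤ) - 1)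
  rw [sub_add_cancel] at h
  rw [chebPoly, Chebyshev.C_eq_S_sub_X_mul_S]
  linear_combination (4 : R[X]) * h

variable (R) in
theorem X_sq_sub_four_mul_derivative_chebPoly_sq (n : ℕ) :
    ((X : R[X]) ^ 2 - 4) * derivative (chebPoly n R) ^ 2 =
      (n : R[X]) ^ 2 * (chebPoly n R ^ 2 - 4) := by
  rw [derivative_chebPoly, chebPoly_sq_sub_four]
  ring

theorem sq_ne_four_of_chebMap {n : ℕ} {x : R} (h : chebMap n R x ^ 2 ≠ 4) : x ^ 2 ≠ 4 := by
  intro hx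
  have := congrArg (eval x) (chebPoly_sq_sub_four R n)
  simp only [eval_sub, eval_pow, eval_mul, eval_X, eval_ofNat, hx, sub_self, zero_mul] at this
  exact h (sub_eq_zero.mp this)

theorem separable_chebPoly_sub_C {κ : Type*} [Field κ] {n : ℕ} (hn : (n : κ) ≠ 0) {a : κ}
    (ha : a ^ 2 ≠ 4) : (chebPoly n κ - C a).Separable := by
  have hC : IsUnit (C ((n : κ) ^ 2 * (a ^ 2 - 4))) :=
    isUnit_C.mpr (mul_ne_zero (pow_ne_zero _ hn) (sub_ne_zero.mpr ha)).isUnit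
  obtain ⟨c, hc⟩ := hC.exists_left_inv
  have h := X_sq_sub_four_mul_derivative_chebPoly_sq κ n
  refine ⟨-c * (n : κ[X]) ^ 2 * (chebPoly n κ + C a),
    c * (X ^ 2 - 4) * derivative (chebPoly n κ), ?_⟩
  rw [derivative_sub, derivative_C, sub_zero]
  simp only [C_mul, C_sub, C_pow, map_natCast, map_ofNat] at hc
  linear_combination c * h + hc

theorem exists_injective_chebMap_eq {κ : Type*} [Field κ] [IsAlgClosed κ] {n : ℕ}
    (hn : (n : κ) ≠ 0) {a : κ} (ha : a ^ 2 ≠ 4) :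
    ∃ b : Fin n → κ, b.Injective ∧ ∀ i, chebMap n κ (b i) = a := by
  have hcard : Fintype.card ((chebPoly n κ - C a).rootSet κ) = n := by
    rw [card_rootSet_eq_natDegree (separable_chebPoly_sub_C hn ha) (IsAlgClosed.splits _),
      natDegree_sub_C, (isMonicOfDegree_chebPoly κ (by rintro rfl; simp at hn)).natDegree_eq]
  let e := (Fintype.equivFinOfCardEq hcard).symm
  refine ⟨fun i ↦ e i, Subtype.val_injective.comp e.injective, fun i ↦ ?_⟩
  have := aeval_eq_zero_of_mem_rootSet (e i).2
  rwa [map_sub, aeval_chebPoly, aeval_C, sub_eq_zero] at this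

end Chebyshev

section AddInv

variable {R : Type*} [CommRing R]

/-- The parametrization `u ↦ u + u⁻¹` of the line by units, which conjugates `T_n` to `u ↦ uⁿ`. -/
def addInv (u : Rˣ) : R := u + (u⁻¹ : Rˣ)

theorem addInv_inv (u : Rˣ) : addInv u⁻¹ = addInv u := by
  rw [addInv, inv_inv, add_comm, addInv]

theorem map_addInv {S : Type*} [CommRing S] (φ : R →+* S) (u : Rˣ) :
    φ (addInv u) = addInv (Units.map (φ : R →* S) u) := by
  simp [addInv]

theorem chebMap_addInv (n : ℕ) (u : Rˣ) : chebMap n R (addInv u) = addInv (u ^ n) := by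
  induction n using Nat.twoStepInduction with
  | zero => simp [chebMap, chebPoly, addInv, one_add_one_eq_two]
  | one => simp [chebMap, chebPoly]
  | more n ih₁ ih₂ =>
    have hrec : chebMap (n + 2) R (addInv u) =
        addInv u * chebMap (n + 1) R (addInv u) - chebMap n R (addInv u) := by
      have := congrArg (eval (addInv u)) (Chebyshev.C_add_two R (n : ℤ))
      rwa [eval_sub, eval_mul, eval_X] at this
    have hu := u.mul_inv
    rw [hrec, ih₁, ih₂]
    simp only [addInv, pow_succ, mul_inv, Units.val_mul]
    linear_combination ((u ^ n : Rˣ) + ((u ^ n)⁻¹ : Rˣ) : R) * hu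

theorem addInv_pow_char_pow (p : ℕ) [Fact p.Prime] [CharP R p] (r : ℕ) (u : Rˣ) :
    addInv u ^ p ^ r = addInv (u ^ p ^ r) := by
  rw [addInv, add_pow_char_pow, addInv, ← Units.val_pow_eq_pow_val, ← Units.val_pow_eq_pow_val,
    inv_pow]

variable [IsDomain R]

theorem addInv_eq_addInv_iff {u w : Rˣ} : addInv u = addInv w ↔ u = w ∨ u = w⁻¹ := by
  have key : (addInv u - addInv w) * u = (u - w) * (u - (w⁻¹ : Rˣ)) := by
    simp only [addInv]
    linear_combination u.inv_mul - w.mul_inv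
  rw [← sub_eq_zero, ← mul_eq_zero_iff_right u.ne_zero, key, mul_eq_zero, sub_eq_zero, sub_eq_zero,
    Units.val_inj, Units.val_inj]

theorem addInv_pow_eq_addInv_pow_iff {u : Rˣ} {m n : ℕ} :
    addInv (u ^ m) = addInv (u ^ n) ↔ ∃ e : ℤˣ, (orderOf u : ℤ) ∣ m - e * n := by
  have hpos : (orderOf u : ℤ) ∣ m - n ↔ u ^ m = u ^ n := by
    rw [orderOf_dvd_sub_iff_zpow_eq_zpow, zpow_natCast, zpow_natCast]
  have hneg : (orderOf u : ℤ) ∣ m - -n ↔ u ^ m = (u ^ n)⁻¹ := by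
    rw [orderOf_dvd_sub_iff_zpow_eq_zpow, zpow_natCast, zpow_neg, zpow_natCast]
  rw [addInv_eq_addInv_iff, ← hpos, ← hneg]
  refine ⟨?_, ?_⟩
  · rintro (h | h)
    exacts [⟨1, by simpa using h⟩, ⟨-1, by simpa using h⟩]
  · rintro ⟨e, he⟩
    rcases Int.units_eq_one_or e with rfl | rfl
    exacts [Or.inl (by simpa using he), Or.inr (by simpa using he)]

theorem addInv_surjective {κ : Type*} [Field κ] [IsAlgClosed κ] :
    (addInv : κˣ → κ).Surjective := by
  intro a
  obtain ⟨z, hz⟩ := IsAlgClosed.exists_root (X ^ 2 - C a * X + C 1)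
    (degree_ne_of_natDegree_ne (n := 0) (by
      rw [(isMonicOfDegree_sub_add_two a 1).natDegree_eq]; exact two_ne_zero))
  have hz' : z ^ 2 - a * z + 1 = 0 := by simpa using hz
  have hz0 : z ≠ 0 := by
    rintro rfl
    simp at hz'
  refine ⟨Units.mk0 z hz0, ?_⟩
  rw [addInv, Units.val_mk0, Units.val_inv_eq_inv_val, Units.val_mk0]
  field_simp
  linear_combination hz'

end AddInv

section SurjectivePrimeTo

variable {p : ℕ} {A B : Type*} [CommRing A] [CommRing B]

/-- A ring homomorphism whose image contains every element up to an integer factor prime to `p`.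
Homomorphisms to a field of characteristic `p` extend uniquely along it, if they extend to the
image at all. -/
def SurjectivePrimeTo (p : ℕ) (i : B →+* A) : Prop :=
  ∀ a, ∃ c : ℤ, ¬ (p : ℤ) ∣ c ∧ (c : A) * a ∈ i.range

/-- `x` generates the ring `A` up to integer factors prime to `p`. -/
abbrev GeneratesPrimeTo (p : ℕ) (x : A) : Prop :=
  SurjectivePrimeTo p (aeval x : ℤ[X] →ₐ[ℤ] A).toRingHom

section CharP

variable {κ : Type*} [Field κ] [CharP κ p] {i : B →+* A}

theorem SurjectivePrimeTo.exists_mul_eq (hi : SurjectivePrimeTo p i) (a : A) :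
    ∃ (c : ℤ) (x : B), (c : κ) ≠ 0 ∧ c * a = i x := by
  obtain ⟨c, hc, x, hx⟩ := hi a
  exact ⟨c, x, by rwa [Ne, CharP.intCast_eq_zero_iff κ p], hx.symm⟩

theorem SurjectivePrimeTo.ringHom_ext (hi : SurjectivePrimeTo p i) {ψ ψ' : A →+* κ}
    (h : ψ.comp i = ψ'.comp i) : ψ = ψ' := by
  ext a
  obtain ⟨c, x, hc, hx⟩ := hi.exists_mul_eq (κ := κ) a
  refine mul_left_cancel₀ hc ?_
  rw [← map_intCast ψ, ← map_mul, hx, ← RingHom.comp_apply, h, RingHom.comp_apply, ← hx, map_mul,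
    map_intCast, map_intCast]

theorem SurjectivePrimeTo.exists_comp_eq (hi : SurjectivePrimeTo p i) (φ : B →+* κ)
    (hker : RingHom.ker i ≤ RingHom.ker φ) : ∃ ψ : A →+* κ, ψ.comp i = φ := by
  choose c x hc hx using hi.exists_mul_eq (κ := κ)
  have key {a : A} {c' : ℤ} {x' : B} (hc' : (c' : κ) ≠ 0) (hx' : c' * a = i x') :
      φ (x a) / c a = φ x' / c' := by
    have hmem : x a * c' - x' * c a ∈ RingHom.ker i := by
      rw [RingHom.mem_ker, map_sub, map_mul, map_mul, map_intCast, map_intCast, ← hx, ← hx']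
      ring
    have := hker hmem
    rw [RingHom.mem_ker, map_sub, map_mul, map_mul, map_intCast, map_intCast, sub_eq_zero] at this
    rwa [div_eq_div_iff (hc a) hc']
  refine ⟨{
    toFun := fun a ↦ φ (x a) / c a
    map_one' := ?_
    map_mul' := fun a b ↦ ?_
    map_zero' := ?_
    map_add' := fun a b ↦ ?_ }, ?_⟩
  · simpa using key (a := 1) (c' := 1) (x' := 1) (by simp) (by simp)
  · have := key (a := a * b) (c' := c a * c b) (x' := x a * x b)
      (by simp [hc]) (by push_cast; rw [map_mul, ← hx, ← hx]; ring)
    rw [this, map_mul, Int.cast_mul, div_mul_div_comm]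
  · simpa using key (a := 0) (c' := 1) (x' := 0) (by simp) (by simp)
  · have := key (a := a + b) (c' := c a * c b) (x' := x a * c b + c a * x b)
      (by simp [hc]) (by push_cast; simp only [map_add, map_mul, map_intCast, ← hx]; ring)
    rw [this, div_add_div _ _ (hc a) (hc b)]
    simp
  · ext y
    simpa using key (a := i y) (c' := 1) (x' := y) (by simp) (by simp)

theorem map_aeval_int (ψ : A →+* B) (x : A) (f : ℤ[X]) : ψ (aeval x f) = aeval (ψ x) f :=
  (aeval_algHom_apply ψ.toIntAlgHom x f).symm

theorem GeneratesPrimeTo.ringHom_ext {x : A} (hx : GeneratesPrimeTo p x) {ψ ψ' : A →+* κ}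
    (h : ψ x = ψ' x) : ψ = ψ' := by
  refine SurjectivePrimeTo.ringHom_ext hx (RingHom.ext fun f ↦ ?_)
  exact (map_aeval_int ψ x f).trans (h ▸ (map_aeval_int ψ' x f).symm)

theorem GeneratesPrimeTo.exists_apply_eq {x : A} (hx : GeneratesPrimeTo p x) (b : κ)
    (hb : ∀ f : ℤ[X], aeval x f = 0 → aeval b f = 0) : ∃ ψ : A →+* κ, ψ x = b := by
  obtain ⟨ψ, hψ⟩ := SurjectivePrimeTo.exists_comp_eq hx (aeval b : ℤ[X] →ₐ[ℤ] κ).toRingHom hb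
  exact ⟨ψ, by simpa using RingHom.congr_fun hψ X⟩

end CharP

theorem GeneratesPrimeTo.exists_sub_eval₂_mem [Fact p.Prime] {x : A}
    (hx : GeneratesPrimeTo p x) (i : B →+* A) {I : Ideal B}
    (hI : (p : B) ∈ I) (a : A) : ∃ f : B[X], a - f.eval₂ i x ∈ I.map i := by
  obtain ⟨c, hc, f, hf⟩ := hx a
  obtain ⟨u, w, huw⟩ : IsCoprime c (p : ℤ) :=
    ((Nat.prime_iff_prime_int.mp Fact.out).coprime_iff_not_dvd.mpr hc).symm
  have hf' : (f.map (Int.castRingHom B)).eval₂ i x = c * a := by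
    rw [← hf, eval₂_map, RingHom.eq_intCast' (i.comp (Int.castRingHom B))]
    rfl
  refine ⟨C (u : B) * f.map (Int.castRingHom B), ?_⟩
  have huw' : (u : A) * c + w * p = 1 := by exact_mod_cast congrArg (Int.cast (R := A)) huw
  have : a - eval₂ i x (C (u : B) * f.map (Int.castRingHom B)) = w * a * i p := by
    rw [eval₂_mul, hf', eval₂_C, map_intCast, map_natCast]
    linear_combination (-a) * huw'
  exact this ▸ Ideal.mul_mem_left _ _ (Ideal.mem_map_of_mem _ hI)

end SurjectivePrimeTo

section PrimesAbove

variable {p : ℕ} {κ : Type*} [Field κ] [CharP κ p]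

theorem natCast_mem_ker {R : Type*} [CommRing R] (φ : R →+* κ) : (p : R) ∈ RingHom.ker φ := by
  rw [RingHom.mem_ker, map_natCast, CharP.cast_eq_zero]

variable [Fact p.Prime]

section Integral

variable {A : Type*} [CommRing A] [Algebra.IsIntegral ℤ A]

theorem isMaximal_of_natCast_mem (P : Ideal A) [hP : P.IsPrime] (hp : (p : A) ∈ P) :
    P.IsMaximal := by
  apply Ideal.isMaximal_of_isIntegral_of_isMaximal_comap (R := ℤ)
  have hspan : (Ideal.span {(p : ℤ)}).IsMaximal := Int.ideal_span_isMaximal_of_prime p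
  rwa [← hspan.eq_of_le (hP.comap _).ne_top]
  rw [Ideal.span_singleton_le_iff_mem]
  simpa using hp

theorem exists_ringHom_ker_eq [IsAlgClosed κ] (P : Ideal A) [P.IsPrime] (hp : (p : A) ∈ P) :
    ∃ φ : A →+* κ, RingHom.ker φ = P := by
  have hmax := isMaximal_of_natCast_mem P hp
  let := Ideal.Quotient.field P
  have hpP : (p : A ⧸ P) = 0 := by
    rwa [← map_natCast (Ideal.Quotient.mk P), Ideal.Quotient.eq_zero_iff_mem]
  have : CharP (A ⧸ P) p := (CharP.charP_iff_prime_eq_zero Fact.out).mpr hpP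
  let := ZMod.algebra (A ⧸ P) p
  let := ZMod.algebra κ p
  have : Algebra.IsIntegral ℤ (A ⧸ P) := inferInstance
  have : Algebra.IsIntegral (ZMod p) (A ⧸ P) := .tower_top (R := ℤ)
  let f : (A ⧸ P) →ₐ[ZMod p] κ := IsAlgClosed.lift
  refine ⟨f.toRingHom.comp (Ideal.Quotient.mk P), ?_⟩
  rw [RingHom.ker_comp_of_injective _ f.toRingHom.injective, Ideal.mk_ker]

end Integral

variable {R A : Type*} [CommRing R] [CommRing A] {ι : R →+* A} {φ : R →+* κ} {θ : A} {g : R[X]}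
  {N : ℕ}

theorem map_ker_le_ker {ψ : A →+* κ} (hψ : ψ.comp ι = φ) :
    (RingHom.ker φ).map ι ≤ RingHom.ker ψ := by
  rw [Ideal.map_le_iff_le_comap, RingHom.comap_ker, hψ]

theorem eval₂_mem_map_ker {f : R[X]} (hf : f.map φ = 0) :
    f.eval₂ ι θ ∈ (RingHom.ker φ).map ι := by
  rw [eval₂_eq_sum_range]
  refine Ideal.sum_mem _ fun i _ ↦ Ideal.mul_mem_right _ _ (Ideal.mem_map_of_mem _ ?_)
  rw [RingHom.mem_ker, ← coeff_map, hf, coeff_zero]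

-- Modulo `(ker φ)A`, an element is a polynomial in `θ` of degree less than `N`; if all `ψ i` kill
-- it, the image of that polynomial under `φ` has `N` distinct zeros.
theorem map_ker_eq_iInf_ker (hθ : GeneratesPrimeTo p θ)
    (hg : IsMonicOfDegree g N) (hgθ : g.eval₂ ι θ = 0) {ψ : Fin N → A →+* κ}
    (hψ : ∀ i, (ψ i).comp ι = φ) (hinj : Function.Injective fun i ↦ ψ i θ) :
    (RingHom.ker φ).map ι = ⨅ i, RingHom.ker (ψ i) := by
  refine le_antisymm (le_iInf fun i ↦ map_ker_le_ker (hψ i)) fun a ha ↦ ?_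
  rw [Submodule.mem_iInf] at ha
  have := φ.domain_nontrivial
  obtain ⟨f, hf⟩ := hθ.exists_sub_eval₂_mem ι (natCast_mem_ker (p := p) φ) a
  rw [← eval₂_modByMonic_eq_self_of_root hgθ] at hf
  have hroot (i : Fin N) : ((f %ₘ g).map φ).eval (ψ i θ) = 0 := by
    have h := map_ker_le_ker (hψ i) hf
    rwa [RingHom.mem_ker, map_sub, ha i, zero_sub, neg_eq_zero, hom_eval₂, hψ, ← eval_map] at h
  have hdeg : ((f %ₘ g).map φ).degree < (Finset.univ : Finset (Fin N)).card := by
    rw [Finset.card_fin, ← hg.natDegree_eq, ← degree_eq_natDegree hg.ne_zero]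
    exact degree_map_le.trans_lt (degree_modByMonic_lt f hg.monic)
  have hzero : (f %ₘ g).map φ = 0 :=
    eq_zero_of_degree_lt_of_eval_index_eq_zero _ hinj.injOn hdeg fun i _ ↦ hroot i
  simpa using Ideal.add_mem _ hf (eval₂_mem_map_ker (ι := ι) (θ := θ) hzero)

theorem isPrime_map_ker (hθ : GeneratesPrimeTo p θ)
    (hg : IsMonicOfDegree g N) (hN : 0 < N) (hgθ : g.eval₂ ι θ = 0) {r : ℕ}
    (hφ : ∀ x, φ x ^ p ^ r = φ x) {ψ : A →+* κ} (hψ : ψ.comp ι = φ)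
    (hconj : ∀ k, 0 < k → k < N → ψ θ ^ (p ^ r) ^ k ≠ ψ θ) :
    ((RingHom.ker φ).map ι).IsPrime := by
  let F := iterateFrobenius κ p r
  have hF : Function.Injective F := iterateFrobenius_inj κ p r
  have hiter (k : ℕ) (y : κ) : F^[k] y = y ^ (p ^ r) ^ k := by
    rw [← congrFun (pow_iterate (p ^ r) k) y]
    rfl
  let Ψ (k : Fin N) : A →+* κ := (F ^ (k : ℕ)).comp ψ
  have hΨ (k : Fin N) (a : A) : Ψ k a = F^[k] (ψ a) := by
    simp only [Ψ, RingHom.comp_apply, RingHom.coe_pow]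
  have hinj : Function.Injective fun k ↦ Ψ k θ := by
    intro k l hkl
    simp only [hΨ] at hkl
    by_contra hne
    wlog hlt : l < k generalizing k l
    · exact this hkl.symm (Ne.symm hne) (lt_of_le_of_ne (not_lt.mp hlt) hne)
    exact hconj (k - l) (Nat.sub_pos_of_lt hlt) ((Nat.sub_le _ _).trans_lt k.2)
      (hiter _ _ ▸ Function.iterate_cancel hF hkl)
  have hcomp (k : Fin N) : (Ψ k).comp ι = φ := by
    ext x
    rw [RingHom.comp_apply, hΨ, ← RingHom.comp_apply ψ, hψ]
    exact Function.iterate_fixed (hφ x) k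
  have hker (k : Fin N) : RingHom.ker (Ψ k) = RingHom.ker ψ := by
    refine RingHom.ker_comp_of_injective _ ?_
    rw [RingHom.coe_pow]
    exact hF.iterate k
  have : Nonempty (Fin N) := ⟨0, hN⟩
  rw [map_ker_eq_iInf_ker hθ hg hgθ hcomp hinj, iInf_congr hker, iInf_const]
  exact RingHom.ker_isPrime ψ

theorem isProdDistinctPrimes_map_ker [Algebra.IsIntegral ℤ A]
    (hθ : GeneratesPrimeTo p θ)
    (hg : IsMonicOfDegree g N) (hgθ : g.eval₂ ι θ = 0) {ψ : Fin N → A →+* κ}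
    (hψ : ∀ i, (ψ i).comp ι = φ) (hinj : Function.Injective fun i ↦ ψ i θ)
    (hrange : ∀ i, ψ i θ ∈ φ.range) : IsProdDistinctPrimes ((RingHom.ker φ).map ι) N := by
  have hker : Function.Injective fun i ↦ RingHom.ker (ψ i) := by
    intro i j hij
    obtain ⟨z, hz⟩ := hrange i
    have hval (k : Fin N) : ι z - θ ∈ RingHom.ker (ψ k) ↔ φ z = ψ k θ := by
      rw [RingHom.mem_ker, map_sub, sub_eq_zero, ← hψ k, RingHom.comp_apply]
    have hzi : ι z - θ ∈ RingHom.ker (ψ i) := (hval i).mpr hz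
    simp only at hij
    rw [hij] at hzi
    exact hinj (hz.symm.trans ((hval j).mp hzi))
  have hprime (i : Fin N) : (RingHom.ker (ψ i)).IsPrime := RingHom.ker_isPrime (ψ i)
  have hmax (i : Fin N) : (RingHom.ker (ψ i)).IsMaximal :=
    isMaximal_of_natCast_mem _ (natCast_mem_ker (p := p) (ψ i))
  refine ⟨Finset.univ.map ⟨_, hker⟩, by simp, ?_, ?_⟩
  · simp only [Finset.mem_map, Finset.mem_univ, true_and]
    rintro _ ⟨i, rfl⟩
    exact hprime i
  · rw [Finset.prod_map, map_ker_eq_iInf_ker hθ hg hgθ hψ hinj]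
    simp only [Function.Embedding.coeFn_mk]
    rw [Ideal.prod_eq_iInf_of_pairwise_isCoprime
      fun i _ j _ hij ↦ Ideal.isCoprime_of_isMaximal (hker.ne hij)]
    simp

end PrimesAbove

section PrimeField

variable {p : ℕ} [Fact p.Prime] {κ : Type*} [Field κ] [CharP κ p]

theorem exists_intCast_eq_of_pow_eq {x : κ} (hx : x ^ p = x) : ∃ z : ℤ, (z : κ) = x := by
  have hmem : x ∈ (ZMod.castHom (dvd_refl p) κ).fieldRange :=
    (bot_le : (⊥ : Subfield κ) ≤ _) ((Subfield.mem_bot_iff_pow_eq_self κ p).mpr hx)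
  obtain ⟨y, rfl⟩ := hmem
  obtain ⟨z, rfl⟩ := ZMod.intCast_surjective y
  exact ⟨z, by simp⟩

theorem mem_range_of_pow_sq_eq {A : Type*} [CommRing A] (φ : A →+* κ) {z : A}
    (hz : φ z ^ p ≠ φ z) (hz2 : φ z ^ p ^ 2 = φ z) {x : κ} (hx : x ^ p ^ 2 = x) :
    x ∈ φ.range := by
  set w := φ z
  rw [sq, pow_mul] at hz2 hx
  have hw : w - w ^ p ≠ 0 := sub_ne_zero.mpr hz.symm
  set b := (x - x ^ p) / (w - w ^ p) with hb
  have hbp : b ^ p = b := by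
    rw [hb, div_pow, sub_pow_char, sub_pow_char, hz2, hx, ← neg_sub x, ← neg_sub w, neg_div_neg_eq]
  obtain ⟨m, hm⟩ := exists_intCast_eq_of_pow_eq hbp
  have ha : (x - b * w) ^ p = x - b * w := by
    rw [sub_pow_char, mul_pow, hbp]
    linear_combination div_mul_cancel₀ (x - x ^ p) hw
  obtain ⟨k, hk⟩ := exists_intCast_eq_of_pow_eq ha
  refine ⟨k + m * z, ?_⟩
  rw [map_add, map_mul, map_intCast, map_intCast, hk, hm]
  ring

end PrimeField

section BackwardOrbit

variable {S : Type*} {T : S → S} {b b' : ℕ → S}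

/-- `b` is a backward orbit of `T`: a sequence of iterated preimages of `b 0`. -/
def IsBackwardOrbit (T : S → S) (b : ℕ → S) : Prop :=
  ∀ n, T (b (n + 1)) = b n

theorem IsBackwardOrbit.iterate_apply_add (hb : IsBackwardOrbit T b) (m k : ℕ) :
    T^[k] (b (m + k)) = b m := by
  induction k with
  | zero => rfl
  | succ k ih => rw [Function.iterate_succ_apply, ← add_assoc, hb, ih]

theorem IsBackwardOrbit.mem_periodicPts [Finite S] (hb : IsBackwardOrbit T b) (n : ℕ) :
    b n ∈ Function.periodicPts T := by
  obtain ⟨i, j, hij, heq⟩ : ∃ i j, i < j ∧ b (n + i) = b (n + j) := by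
    obtain ⟨i, j, hne, heq⟩ := Finite.exists_ne_map_eq_of_infinite fun i ↦ b (n + i)
    rcases hne.lt_or_gt with h | h
    exacts [⟨i, j, h, heq⟩, ⟨j, i, h, heq.symm⟩]
  have hperiodic : b (n + j) ∈ Function.periodicPts T := by
    refine ⟨j - i, Nat.sub_pos_of_lt hij, ?_⟩
    have := hb.iterate_apply_add (n + i) (j - i)
    rwa [add_assoc, Nat.add_sub_cancel' hij.le, heq] at this
  rw [← hb.iterate_apply_add n j]
  exact (Function.bijOn_periodicPts T).mapsTo.iterate j hperiodic

theorem IsBackwardOrbit.eq_of_apply_zero_eq [Finite S] (hb : IsBackwardOrbit T b)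
    (hb' : IsBackwardOrbit T b') (h0 : b 0 = b' 0) : b = b' := by
  funext n
  induction n with
  | zero => exact h0
  | succ n ih =>
    refine (Function.bijOn_periodicPts T).injOn (hb.mem_periodicPts _) (hb'.mem_periodicPts _) ?_
    rw [hb, hb', ih]

theorem exists_isBackwardOrbit {a : S} (ha : a ∈ Function.periodicPts T) :
    ∃ b, b 0 = a ∧ IsBackwardOrbit T b := by
  have hsurj (x : Function.periodicPts T) : ∃ y : Function.periodicPts T, T y = x := by
    obtain ⟨y, hy, h⟩ := (Function.bijOn_periodicPts T).surjOn x.2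
    exact ⟨⟨y, hy⟩, h⟩
  choose g hg using hsurj
  refine ⟨fun n ↦ g^[n] ⟨a, ha⟩, rfl, fun n ↦ ?_⟩
  simp only [Function.iterate_succ_apply']
  exact hg _

theorem IsBackwardOrbit.chebMap_pow_sub {R : Type*} [CommRing R] {ℓ : ℕ} {x : ℕ → R}
    (hx : IsBackwardOrbit (chebMap ℓ R) x) {m n : ℕ} (hmn : m ≤ n) :
    chebMap (ℓ ^ (n - m)) R (x n) = x m := by
  conv_lhs => rw [chebMap_pow, ← Nat.add_sub_cancel' hmn, Nat.add_sub_cancel_left]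
  exact hx.iterate_apply_add m (n - m)

end BackwardOrbit

section NumberField

theorem minpoly_int_eq_of_irreducible {A : Type*} [CommRing A] [IsDomain A] [CharZero A] {f : ℤ[X]}
    (hf : f.Monic) (hirr : Irreducible f) {x : A} (hx : aeval x f = 0) : minpoly ℤ x = f := by
  have hint : IsIntegral ℤ x := ⟨f, hf, hx⟩
  have hassoc := (hirr.dvd_iff.mp (minpoly.isIntegrallyClosed_dvd hint hx)).resolve_left
    (minpoly.not_isUnit ℤ x)
  exact eq_of_monic_of_associated (minpoly.monic hint) hf hassoc.symm

-- `f'(x)` times the inverse different is `ℤ[x]`, where `f` is the minimal polynomial of `x`.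
theorem generatesPrimeTo_of_derivative_minpoly_dvd {K : Type*} [Field K] [NumberField K] {p : ℕ}
    {x : 𝓞 K} (hx : Algebra.adjoin ℚ {(x : K)} = ⊤) {c : ℤ} (hc : ¬ (p : ℤ) ∣ c)
    (hdvd : aeval x (derivative (minpoly ℤ x)) ∣ (c : 𝓞 K)) : GeneratesPrimeTo p x := by
  intro a
  obtain ⟨y, hy⟩ := hdvd
  have hmem : (c : 𝓞 K) ∈ conductor ℤ x := by
    rw [hy]
    refine Ideal.mul_mem_right _ _ (Ideal.mul_le_left (J := differentIdeal ℤ (𝓞 K)) ?_)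
    rw [conductor_mul_differentIdeal ℤ ℚ K x hx]
    exact Ideal.mem_span_singleton_self _
  have := hmem a
  rw [Algebra.adjoin_singleton_eq_range_aeval] at this
  exact ⟨c, hc, this⟩

end NumberField

section Tower

variable {ℓ p : ℕ} {t : ℤ} {L : Type*} [Field L] {θ : ℕ → L}

theorem IsCompatible.isBackwardOrbit (hθ : IsCompatible ℓ t θ) : IsBackwardOrbit (chebMap ℓ L) θ :=
  hθ.2

theorem isMonicOfDegree_chebPoly_sub_C {R : Type*} [CommRing R] [Nontrivial R] {n : ℕ} (hn : n ≠ 0)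
    (a : R) : IsMonicOfDegree (chebPoly n R - C a) n :=
  (isMonicOfDegree_chebPoly R hn).sub (by simpa using Nat.pos_of_ne_zero hn)

theorem aeval_chebPoly_sub_C_eq_zero_iff {A : Type*} [CommRing A] {n : ℕ} {x : A} :
    aeval x (chebPoly n ℤ - C t) = 0 ↔ chebMap n A x = t := by
  rw [map_sub, aeval_chebPoly, aeval_C, sub_eq_zero, algebraMap_int_eq, eq_intCast]

theorem IsCompatible.chebMap_pow_eq_intCast (hθ : IsCompatible ℓ t θ) (n : ℕ) :
    chebMap (ℓ ^ n) L (θ n) = t := by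
  rw [← hθ.1, ← hθ.isBackwardOrbit.chebMap_pow_sub n.zero_le, Nat.sub_zero]

theorem IsCompatible.isIntegral (hθ : IsCompatible ℓ t θ) (hℓ : ℓ ≠ 0) (n : ℕ) :
    IsIntegral ℤ (θ n) :=
  ⟨_, (isMonicOfDegree_chebPoly_sub_C (pow_ne_zero n hℓ) t).monic,
    aeval_chebPoly_sub_C_eq_zero_iff.mpr (hθ.chebMap_pow_eq_intCast n)⟩

/-- The standing hypotheses on the tower of the `K_n = ℚ(θ_n)`: it has degree `ℓ` at each step, and
`p` divides neither `ℓ` nor `4 - t²`, hence no discriminant of a polynomial `T_ℓⁿ - t`. -/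
structure UnramifiedTower (p ℓ : ℕ) (t : ℤ) (θ : ℕ → L) : Prop where
  compatible : IsCompatible ℓ t θ
  irreducible : ∀ n, Irreducible (chebPoly (ℓ ^ n) ℤ - C t)
  not_dvd : ¬ (p : ℤ) ∣ ℓ * (4 - t ^ 2)

namespace UnramifiedTower

theorem of_irreducible_chebIter (hθ : IsCompatible ℓ t θ)
    (hirr : ∀ n, 1 ≤ n → Irreducible (chebIter ℓ ℤ n - C t))
    (hp : ¬ (p : ℤ) ∣ ℓ * (4 - t ^ 2)) : UnramifiedTower p ℓ t θ where
  compatible := hθ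
  irreducible
    | 0 => by simpa [chebPoly] using irreducible_X_sub_C t
    | n + 1 => chebPoly_pow (R := ℤ) ℓ (n + 1) ▸ hirr (n + 1) n.succ_pos
  not_dvd := hp

theorem ne_zero (hT : UnramifiedTower p ℓ t θ) : ℓ ≠ 0 := by
  rintro rfl
  simpa using hT.not_dvd

theorem isIntegral (hT : UnramifiedTower p ℓ t θ) (n : ℕ) : IsIntegral ℤ (θ n) :=
  hT.compatible.isIntegral hT.ne_zero n

end UnramifiedTower

variable [CharZero L]

theorem level_le_levelInfty (θ : ℕ → L) (n : ℕ) : level θ n ≤ levelInfty θ := le_iSup (level θ) n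

theorem IsCompatible.level_mono (hθ : IsCompatible ℓ t θ) : Monotone (level θ) := by
  intro m n hmn
  rw [level, IntermediateField.adjoin_simple_le_iff, ← hθ.isBackwardOrbit.chebMap_pow_sub hmn,
    ← aeval_chebPoly ℚ]
  exact IntermediateField.algebra_adjoin_le_adjoin _ _ (aeval_mem_adjoin_singleton _ _)

namespace UnramifiedTower

theorem finrank_level (hT : UnramifiedTower p ℓ t θ) (n : ℕ) :
    Module.finrank ℚ (level θ n) = ℓ ^ n := by
  have hmonic := isMonicOfDegree_chebPoly_sub_C (pow_ne_zero n hT.ne_zero) t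
  have hint := hT.isIntegral n
  rw [level, IntermediateField.adjoin.finrank hint.tower_top,
    minpoly.isIntegrallyClosed_eq_field_fractions' ℚ hint, (minpoly.monic hint).natDegree_map,
    minpoly_int_eq_of_irreducible hmonic.monic (hT.irreducible n)
      (aeval_chebPoly_sub_C_eq_zero_iff.mpr (hT.compatible.chebMap_pow_eq_intCast n)),
    hmonic.natDegree_eq]

theorem relfinrank_level (hT : UnramifiedTower p ℓ t θ) {m n : ℕ} (hmn : m ≤ n) :
    IntermediateField.relfinrank (level θ m) (level θ n) = ℓ ^ (n - m) := by
  have h := IntermediateField.finrank_bot_mul_relfinrank (hT.compatible.level_mono hmn)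
  rw [hT.finrank_level, hT.finrank_level, ← pow_mul_pow_sub ℓ hmn] at h
  exact Nat.eq_of_mul_eq_mul_left (Nat.pos_of_ne_zero (pow_ne_zero m hT.ne_zero)) h

/-- The point `θ n` as an element of the ring of integers of `K_n`. -/
def gen (hT : UnramifiedTower p ℓ t θ) (n : ℕ) : 𝓞 (level θ n) :=
  ⟨IntermediateField.AdjoinSimple.gen ℚ (θ n),
    (isIntegral_algHom_iff ((level θ n).val.restrictScalars ℤ) Subtype.val_injective).mp
      (hT.isIntegral n)⟩

theorem chebMap_pow_sub_gen (hT : UnramifiedTower p ℓ t θ) {m n : ℕ} (hmn : m ≤ n) :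
    chebMap (ℓ ^ (n - m)) _ (hT.gen n) =
      ringInclusion (hT.compatible.level_mono hmn) (hT.gen m) := by
  apply FaithfulSMul.algebraMap_injective (𝓞 (level θ n)) L
  rw [map_chebMap]
  exact hT.compatible.isBackwardOrbit.chebMap_pow_sub hmn

theorem chebMap_pow_gen (hT : UnramifiedTower p ℓ t θ) (n : ℕ) :
    chebMap (ℓ ^ n) _ (hT.gen n) = t := by
  apply FaithfulSMul.algebraMap_injective (𝓞 (level θ n)) L
  rw [map_chebMap, map_intCast]
  exact hT.compatible.chebMap_pow_eq_intCast n

theorem minpoly_gen (hT : UnramifiedTower p ℓ t θ) (n : ℕ) :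
    minpoly ℤ (hT.gen n) = chebPoly (ℓ ^ n) ℤ - C t :=
  minpoly_int_eq_of_irreducible
    (isMonicOfDegree_chebPoly_sub_C (pow_ne_zero n hT.ne_zero) t).monic (hT.irreducible n)
    (aeval_chebPoly_sub_C_eq_zero_iff.mpr (hT.chebMap_pow_gen n))

variable [Fact p.Prime]

theorem generatesPrimeTo_gen (hT : UnramifiedTower p ℓ t θ) (n : ℕ) :
    GeneratesPrimeTo p (hT.gen n) := by
  have hint : IsIntegral ℚ (θ n) := (hT.isIntegral n).tower_top
  have : NumberField (level θ n) :=
    { to_finiteDimensional := IntermediateField.adjoin.finiteDimensional hint }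
  have hp : Prime (p : ℤ) := Nat.prime_iff_prime_int.mp Fact.out
  refine generatesPrimeTo_of_derivative_minpoly_dvd (c := (ℓ ^ n : ℕ) ^ 2 * (t ^ 2 - 4))
    (IntermediateField.adjoin.powerBasis hint).adjoin_gen_eq_top (fun h ↦ hT.not_dvd ?_) ?_
  · push_cast at h
    rcases hp.dvd_or_dvd h with h | h
    · exact (hp.dvd_of_dvd_pow (hp.dvd_of_dvd_pow h)).mul_right _
    · exact (dvd_sub_comm.mp h).mul_left _
  · have h := congrArg (aeval (hT.gen n)) (X_sq_sub_four_mul_derivative_chebPoly_sq ℤ (ℓ ^ n))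
    simp only [map_mul, map_pow, map_sub, map_natCast, map_ofNat, aeval_X, aeval_chebPoly,
      hT.chebMap_pow_gen] at h
    rw [hT.minpoly_gen, derivative_sub, derivative_C, sub_zero]
    refine ⟨(hT.gen n ^ 2 - 4) * aeval (hT.gen n) (derivative (chebPoly (ℓ ^ n) ℤ)), ?_⟩
    push_cast at h ⊢
    linear_combination -h

end UnramifiedTower
end Tower

theorem chebMap_surjective {κ : Type*} [Field κ] [IsAlgClosed κ] {n : ℕ} (hn : n ≠ 0) :
    (chebMap n κ).Surjective := by
  intro a
  have hg := isMonicOfDegree_chebPoly_sub_C hn a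
  obtain ⟨b, hb⟩ := IsAlgClosed.exists_root (chebPoly n κ - C a)
    (degree_ne_of_natDegree_ne (n := 0) (by rwa [hg.natDegree_eq]))
  exact ⟨b, by simpa [chebMap, sub_eq_zero] using hb⟩

theorem eval₂_chebPoly_sub_C {R A : Type*} [CommRing R] [CommRing A] (ι : R →+* A) (n : ℕ) (a : R)
    (x : A) : (chebPoly n R - C a).eval₂ ι x = chebMap n A x - ι a := by
  have := @aeval_chebPoly R _ A _ ι.toAlgebra n x
  rw [eval₂_sub, eval₂_C, ← this]
  rfl

theorem map_ker_intCastRingHom {κ : Type*} [Field κ] {p : ℕ} [CharP κ p] {A : Type*} [CommRing A] :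
    (RingHom.ker (Int.castRingHom κ)).map (Int.castRingHom A) = Ideal.span {(p : A)} := by
  rw [← algebraMap_int_eq κ, CharP.ker_intAlgebraMap_eq_span p, Ideal.map_span,
    Set.image_singleton, eq_intCast, Int.cast_natCast]

namespace UnramifiedTower

variable {ℓ p : ℕ} {t : ℤ} {L : Type*} [Field L] {θ : ℕ → L} {κ : Type*} [Field κ]

section

variable [CharP κ p]

variable (κ) in
theorem natCast_ne_zero (hT : UnramifiedTower p ℓ t θ) : (ℓ : κ) ≠ 0 := by
  rw [← Int.cast_natCast, Ne, CharP.intCast_eq_zero_iff κ p]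
  exact fun h ↦ hT.not_dvd (h.mul_right _)

variable (κ) in
theorem natCast_pow_ne_zero (hT : UnramifiedTower p ℓ t θ) (n : ℕ) : ((ℓ ^ n : ℕ) : κ) ≠ 0 := by
  rw [Nat.cast_pow]
  exact pow_ne_zero n (hT.natCast_ne_zero κ)

variable (κ) in
theorem intCast_sq_ne_four (hT : UnramifiedTower p ℓ t θ) : (t : κ) ^ 2 ≠ 4 := by
  intro h
  refine hT.not_dvd (((CharP.intCast_eq_zero_iff κ p _).mp ?_).mul_left _)
  push_cast
  rw [h, sub_self]

end

variable [CharZero L]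

theorem eval₂_ringInclusion_gen_eq_zero (hT : UnramifiedTower p ℓ t θ) {m n : ℕ} (hmn : m ≤ n) :
    (chebPoly (ℓ ^ (n - m)) _ - C (hT.gen m)).eval₂
      (ringInclusion (hT.compatible.level_mono hmn)) (hT.gen n) = 0 := by
  rw [eval₂_chebPoly_sub_C, hT.chebMap_pow_sub_gen hmn, sub_self]

theorem eval₂_intCast_gen_eq_zero (hT : UnramifiedTower p ℓ t θ) (n : ℕ) :
    (chebPoly (ℓ ^ n) ℤ - C t).eval₂ (Int.castRingHom _) (hT.gen n) = 0 := by
  rw [eval₂_chebPoly_sub_C, hT.chebMap_pow_gen, eq_intCast, sub_self]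

theorem chebMap_apply_gen (hT : UnramifiedTower p ℓ t θ) {n : ℕ} (φ : 𝓞 (level θ n) →+* κ) :
    chebMap (ℓ ^ n) κ (φ (hT.gen n)) = t := by
  rw [← map_chebMap, hT.chebMap_pow_gen, map_intCast]

theorem chebMap_pow_eq_of_pow_sub (hT : UnramifiedTower p ℓ t θ) {m n : ℕ} (hmn : m ≤ n)
    {φ : 𝓞 (level θ m) →+* κ} {b : κ} (hb : chebMap (ℓ ^ (n - m)) κ b = φ (hT.gen m)) :
    chebMap (ℓ ^ n) κ b = t := by
  have := hT.chebMap_apply_gen φ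
  rwa [← hb, chebMap_pow, chebMap_pow, ← Function.iterate_add_apply, Nat.add_sub_cancel' hmn,
    ← chebMap_pow] at this

variable [Fact p.Prime] [CharP κ p]

theorem exists_apply_gen_eq (hT : UnramifiedTower p ℓ t θ) {n : ℕ} {b : κ}
    (hb : chebMap (ℓ ^ n) κ b = t) : ∃ ψ : 𝓞 (level θ n) →+* κ, ψ (hT.gen n) = b := by
  refine (hT.generatesPrimeTo_gen n).exists_apply_eq b fun f hf ↦ ?_
  obtain ⟨q, rfl⟩ := minpoly.isIntegrallyClosed_dvd (hT.gen n).isIntegral hf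
  rw [hT.minpoly_gen, map_mul, aeval_chebPoly_sub_C_eq_zero_iff.mpr hb, zero_mul]

theorem exists_comp_ringInclusion_eq (hT : UnramifiedTower p ℓ t θ) {m n : ℕ} (hmn : m ≤ n)
    (φ : 𝓞 (level θ m) →+* κ) {b : κ} (hb : chebMap (ℓ ^ (n - m)) κ b = φ (hT.gen m)) :
    ∃ ψ : 𝓞 (level θ n) →+* κ,
      ψ.comp (ringInclusion (hT.compatible.level_mono hmn)) = φ ∧ ψ (hT.gen n) = b := by
  obtain ⟨ψ, hψ⟩ := hT.exists_apply_gen_eq (hT.chebMap_pow_eq_of_pow_sub hmn hb)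
  refine ⟨ψ, (hT.generatesPrimeTo_gen m).ringHom_ext ?_, hψ⟩
  rw [RingHom.comp_apply, ← hT.chebMap_pow_sub_gen hmn, map_chebMap, hψ, hb]

theorem apply_pow_eq (hT : UnramifiedTower p ℓ t θ) {m r : ℕ}
    {φ : 𝓞 (level θ m) →+* κ} (hφ : φ (hT.gen m) ^ p ^ r = φ (hT.gen m)) (x : 𝓞 (level θ m)) :
    φ x ^ p ^ r = φ x :=
  RingHom.congr_fun ((hT.generatesPrimeTo_gen m).ringHom_ext
    (ψ := (iterateFrobenius κ p r).comp φ) (ψ' := φ) hφ) x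

variable [IsAlgClosed κ]

variable (κ) in
theorem inertAbove (hT : UnramifiedTower p ℓ t θ) {m n : ℕ} (hmn : m ≤ n) {r : ℕ}
    (hfix : ∀ c : κ, chebMap (ℓ ^ m) κ c = t → c ^ p ^ r = c)
    (hconj : ∀ b : κ, chebMap (ℓ ^ n) κ b = t →
      ∀ k, 0 < k → k < ℓ ^ (n - m) → b ^ (p ^ r) ^ k ≠ b) :
    InertAbove p (level θ m) (level θ n) := by
  have hN := pow_ne_zero (n - m) hT.ne_zero
  refine ⟨hT.compatible.level_mono hmn, fun P hP hpP ↦ ?_⟩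
  obtain ⟨φ, rfl⟩ := exists_ringHom_ker_eq (κ := κ) P hpP
  obtain ⟨b, hb⟩ := chebMap_surjective hN (φ (hT.gen m))
  obtain ⟨ψ, hψ, rfl⟩ := hT.exists_comp_ringInclusion_eq hmn φ hb
  exact isPrime_map_ker (hT.generatesPrimeTo_gen n) (isMonicOfDegree_chebPoly_sub_C hN _)
    (Nat.pos_of_ne_zero hN) (hT.eval₂_ringInclusion_gen_eq_zero hmn)
    (hT.apply_pow_eq (hfix _ (hT.chebMap_apply_gen φ))) hψ (hconj _ (hT.chebMap_apply_gen ψ))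

variable (κ) in
theorem splitsCompletelyAbove (hT : UnramifiedTower p ℓ t θ) {m n : ℕ} (hmn : m ≤ n)
    (hne : ∀ c : κ, chebMap (ℓ ^ m) κ c = t → c ^ p ≠ c)
    (hfix : ∀ b : κ, chebMap (ℓ ^ n) κ b = t → b ^ p ^ 2 = b) :
    SplitsCompletelyAbove p (level θ m) (level θ n) := by
  have hN := pow_ne_zero (n - m) hT.ne_zero
  refine ⟨hT.compatible.level_mono hmn, fun P hP hpP ↦ ?_⟩
  obtain ⟨φ, rfl⟩ := exists_ringHom_ker_eq (κ := κ) P hpP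
  have hφ := hT.chebMap_apply_gen φ
  obtain ⟨b, hinj, hb⟩ := exists_injective_chebMap_eq (hT.natCast_pow_ne_zero κ (n - m))
    (sq_ne_four_of_chebMap (hφ.symm ▸ hT.intCast_sq_ne_four κ))
  choose ψ hψ hψb using fun i ↦ hT.exists_comp_ringInclusion_eq hmn φ (hb i)
  have hbfix (i) : b i ^ p ^ 2 = b i := hfix _ (hT.chebMap_pow_eq_of_pow_sub hmn (hb i))
  rw [hT.relfinrank_level hmn]
  refine isProdDistinctPrimes_map_ker (hT.generatesPrimeTo_gen n)
    (isMonicOfDegree_chebPoly_sub_C hN _) (hT.eval₂_ringInclusion_gen_eq_zero hmn) hψ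
    (by simpa only [hψb] using hinj)
    fun i ↦ mem_range_of_pow_sq_eq φ (hne _ hφ) ?_ (hψb i ▸ hbfix i)
  have h0 := Nat.pos_of_ne_zero hN
  rw [← hb ⟨0, h0⟩, ← iterateFrobenius_def, map_chebMap, iterateFrobenius_def, hbfix]

variable (κ) in
theorem inert (hT : UnramifiedTower p ℓ t θ) (n : ℕ)
    (hconj : ∀ b : κ, chebMap (ℓ ^ n) κ b = t → ∀ k, 0 < k → k < ℓ ^ n → b ^ p ^ k ≠ b) :
    Inert p (level θ n) := by
  have hN := pow_ne_zero n hT.ne_zero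
  obtain ⟨b, hb⟩ := chebMap_surjective hN (t : κ)
  obtain ⟨ψ, rfl⟩ := hT.exists_apply_gen_eq hb
  rw [Inert, ← map_ker_intCastRingHom (κ := κ)]
  refine isPrime_map_ker (r := 1) (hT.generatesPrimeTo_gen n) (isMonicOfDegree_chebPoly_sub_C hN t)
    (Nat.pos_of_ne_zero hN) (hT.eval₂_intCast_gen_eq_zero n) (fun x ↦ ?_)
    (RingHom.ext_int (ψ.comp (Int.castRingHom _)) _) (by simpa only [pow_one] using hconj _ hb)
  rw [pow_one, ← frobenius_def, eq_intCast, map_intCast]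

variable (κ) in
theorem splitsCompletely (hT : UnramifiedTower p ℓ t θ) (n : ℕ)
    (hfix : ∀ b : κ, chebMap (ℓ ^ n) κ b = t → b ^ p = b) :
    SplitsCompletely p (level θ n) := by
  obtain ⟨b, hinj, hb⟩ := exists_injective_chebMap_eq (hT.natCast_pow_ne_zero κ n)
    (hT.intCast_sq_ne_four κ)
  choose ψ hψ using fun i ↦ hT.exists_apply_gen_eq (hb i)
  rw [SplitsCompletely, ← map_ker_intCastRingHom (κ := κ), hT.finrank_level]
  exact isProdDistinctPrimes_map_ker (hT.generatesPrimeTo_gen n)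
    (isMonicOfDegree_chebPoly_sub_C (pow_ne_zero n hT.ne_zero) t) (hT.eval₂_intCast_gen_eq_zero n)
    (fun i ↦ RingHom.ext_int ((ψ i).comp (Int.castRingHom _)) _)
    (by simpa only [hψ] using hinj)
    fun i ↦ exists_intCast_eq_of_pow_eq (hψ i ▸ hfix _ (hb i))

end UnramifiedTower

theorem IsBackwardOrbit.mvPolynomial_aeval_eq {ℓ : ℕ} {A : Type*} [CommRing A] {x : ℕ → A}
    (hx : IsBackwardOrbit (chebMap ℓ A) x) {F : MvPolynomial ℕ ℤ} {N : ℕ}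
    (hF : ∀ i ∈ F.vars, i ≤ N) :
    MvPolynomial.aeval x F =
      aeval (x N) (MvPolynomial.aeval (fun i ↦ chebPoly (ℓ ^ (N - i)) ℤ) F) := by
  rw [← AlgHom.comp_apply, MvPolynomial.comp_aeval, MvPolynomial.aeval_def, MvPolynomial.aeval_def]
  refine MvPolynomial.eval₂Hom_congr' rfl (fun i hi _ ↦ ?_) rfl
  rw [aeval_chebPoly, hx.chebMap_pow_sub (hF i hi)]

theorem ringInclusion_injective {L : Type*} [Field L] [CharZero L] {E F : IntermediateField ℚ L}
    (h : E ≤ F) : Function.Injective (ringInclusion h) := fun _ _ hxy ↦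
  RingOfIntegers.ext (IntermediateField.inclusion_injective h congr(($hxy : F)))

theorem IsCompatible.exists_ringInclusion_eq {ℓ : ℕ} {t : ℤ} {L : Type*} [Field L] [CharZero L]
    {θ : ℕ → L} (hθ : IsCompatible ℓ t θ) (x : 𝓞 (levelInfty θ)) :
    ∃ n, ∃ y : 𝓞 (level θ n), ringInclusion (level_le_levelInfty θ n) y = x := by
  have hmono : Monotone (level θ) := fun _ _ hmn ↦ hθ.level_mono hmn
  have hx : ((x : levelInfty θ) : L) ∈ ((⨆ n, level θ n : IntermediateField ℚ L) : Set L) :=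
    (x : levelInfty θ).2
  rw [IntermediateField.coe_iSup_of_directed hmono.directed_le, Set.mem_iUnion] at hx
  obtain ⟨n, hn⟩ := hx
  have hint : IsIntegral ℤ ((x : levelInfty θ) : L) :=
    x.isIntegral_coe.map ((levelInfty θ).val.restrictScalars ℤ)
  exact ⟨n, ⟨⟨_, hn⟩, (isIntegral_algHom_iff
    ((level θ n).val.restrictScalars ℤ) Subtype.val_injective).mp hint⟩, rfl⟩

namespace UnramifiedTower

variable {ℓ p : ℕ} {t : ℤ} {L : Type*} [Field L] [CharZero L] {θ : ℕ → L}

/-- `θ n` as an algebraic integer of `K_∞`. -/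
def genInfty (hT : UnramifiedTower p ℓ t θ) (n : ℕ) : 𝓞 (levelInfty θ) :=
  ringInclusion (level_le_levelInfty θ n) (hT.gen n)

theorem isBackwardOrbit_genInfty (hT : UnramifiedTower p ℓ t θ) :
    IsBackwardOrbit (chebMap ℓ _) hT.genInfty := by
  intro n
  apply FaithfulSMul.algebraMap_injective (𝓞 (levelInfty θ)) L
  rw [map_chebMap]
  exact hT.compatible.isBackwardOrbit n

theorem genInfty_zero (hT : UnramifiedTower p ℓ t θ) : hT.genInfty 0 = t := by
  apply FaithfulSMul.algebraMap_injective (𝓞 (levelInfty θ)) L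
  rw [map_intCast]
  exact hT.compatible.1

theorem isCompatible_apply_genInfty (hT : UnramifiedTower p ℓ t θ) {κ : Type*} [Field κ]
    (ψ : 𝓞 (levelInfty θ) →+* κ) : IsCompatible ℓ t fun n ↦ ψ (hT.genInfty n) := by
  refine ⟨by simp only [hT.genInfty_zero, map_intCast], fun n ↦ ?_⟩
  rw [← map_chebMap, hT.isBackwardOrbit_genInfty n]

theorem surjectivePrimeTo_genInfty [Fact p.Prime] (hT : UnramifiedTower p ℓ t θ) :
    SurjectivePrimeTo p
      (MvPolynomial.aeval hT.genInfty : MvPolynomial ℕ ℤ →ₐ[ℤ] _).toRingHom := by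
  intro x
  obtain ⟨n, y, rfl⟩ := hT.compatible.exists_ringInclusion_eq x
  obtain ⟨c, hc, f, hf⟩ := hT.generatesPrimeTo_gen n y
  refine ⟨c, hc, aeval (MvPolynomial.X n) f, ?_⟩
  have := congr(ringInclusion (level_le_levelInfty θ n) $hf)
  rw [map_mul, map_intCast] at this
  simpa [map_aeval_int, ← aeval_algHom_apply, genInfty] using this

variable {κ : Type*} [Field κ] [CharP κ p] [Fact p.Prime]

theorem ringHom_levelInfty_ext (hT : UnramifiedTower p ℓ t θ) {ψ ψ' : 𝓞 (levelInfty θ) →+* κ}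
    (h : ∀ n, ψ (hT.genInfty n) = ψ' (hT.genInfty n)) : ψ = ψ' := by
  refine hT.surjectivePrimeTo_genInfty.ringHom_ext (MvPolynomial.ringHom_ext' ?_ fun n ↦ ?_)
  · exact RingHom.ext_int _ _
  · simpa using h n

theorem exists_ringHom_levelInfty (hT : UnramifiedTower p ℓ t θ) {b : ℕ → κ}
    (hb : IsCompatible ℓ t b) : ∃ ψ : 𝓞 (levelInfty θ) →+* κ, ∀ n, ψ (hT.genInfty n) = b n := by
  suffices hker :
      RingHom.ker (MvPolynomial.aeval hT.genInfty : MvPolynomial ℕ ℤ →ₐ[ℤ] _).toRingHom ≤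
        RingHom.ker (MvPolynomial.aeval b : MvPolynomial ℕ ℤ →ₐ[ℤ] κ).toRingHom by
    obtain ⟨ψ, hψ⟩ := hT.surjectivePrimeTo_genInfty.exists_comp_eq _ hker
    exact ⟨ψ, fun n ↦ by simpa using RingHom.congr_fun hψ (MvPolynomial.X n)⟩
  intro F hF
  obtain ⟨N, hN⟩ := F.vars.exists_le
  obtain ⟨φ, hφ⟩ := hT.exists_apply_gen_eq (hb.chebMap_pow_eq_intCast N)
  simp only [AlgHom.toRingHom_eq_coe, RingHom.mem_ker, RingHom.coe_coe] at hF ⊢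
  rw [hT.isBackwardOrbit_genInfty.mvPolynomial_aeval_eq hN, genInfty, ← map_aeval_int,
    map_eq_zero_iff _ (ringInclusion_injective _)] at hF
  rw [hb.isBackwardOrbit.mvPolynomial_aeval_eq hN, ← hφ, ← map_aeval_int, hF, map_zero]

end UnramifiedTower

section DegreeOne

variable {p : ℕ} [Fact p.Prime] {L : Type*} [Field L] [CharZero L] {F : IntermediateField ℚ L}

theorem isDegreeOnePrime_ker (φ : 𝓞 F →+* ZMod p) : IsDegreeOnePrime p F (RingHom.ker φ) := by
  have hover : (RingHom.ker φ).LiesOver (Ideal.span {(p : ℤ)}) := by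
    constructor
    rw [← CharP.ker_intAlgebraMap_eq_span (R := ZMod p), Ideal.under, RingHom.comap_ker]
    exact congrArg RingHom.ker (RingHom.ext_int _ _)
  have hpmax : (Ideal.span {(p : ℤ)}).IsMaximal := Int.ideal_span_isMaximal_of_prime p
  have hmax : (RingHom.ker φ).IsMaximal := RingHom.ker_isMaximal_of_surjective φ
    (ZMod.ringHom_surjective φ)
  refine ⟨hmax.isPrime, hover, ?_⟩
  rw [Ideal.inertiaDeg_eq_of_isMaximal (Ideal.span {(p : ℤ)})]
  let := Ideal.Quotient.field (Ideal.span {(p : ℤ)})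
  let := Ideal.Quotient.field (RingHom.ker φ)
  refine finrank_eq_one 1 one_ne_zero fun w ↦ ?_
  obtain ⟨x, rfl⟩ := Ideal.Quotient.mk_surjective w
  obtain ⟨z, hz⟩ := ZMod.intCast_surjective (φ x)
  refine ⟨Ideal.Quotient.mk _ z, ?_⟩
  rw [Algebra.smul_def, mul_one, Ideal.Quotient.algebraMap_mk_of_liesOver, Ideal.Quotient.eq,
    RingHom.mem_ker, map_sub, eq_intCast, map_intCast, hz, sub_self]

theorem IsDegreeOnePrime.exists_ringHom {P : Ideal (𝓞 F)} (hP : IsDegreeOnePrime p F P) :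
    ∃ φ : 𝓞 F →+* ZMod p, RingHom.ker φ = P := by
  obtain ⟨hprime, hover, hdeg⟩ := hP
  have hpmax : (Ideal.span {(p : ℤ)}).IsMaximal := Int.ideal_span_isMaximal_of_prime p
  have hmax : P.IsMaximal := Ideal.IsMaximal.of_liesOver_isMaximal P (Ideal.span {(p : ℤ)})
  rw [Ideal.inertiaDeg_eq_of_isMaximal (Ideal.span {(p : ℤ)})] at hdeg
  let := Ideal.Quotient.field (Ideal.span {(p : ℤ)})
  let := Ideal.Quotient.field P
  have hbij : Function.Bijective (algebraMap (ℤ ⧸ Ideal.span {(p : ℤ)}) (𝓞 F ⧸ P)) := by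
    refine ⟨(algebraMap (ℤ ⧸ Ideal.span {(p : ℤ)}) (𝓞 F ⧸ P)).injective, fun w ↦ ?_⟩
    obtain ⟨c, hc⟩ := (finrank_eq_one_iff_of_nonzero' (1 : 𝓞 F ⧸ P) one_ne_zero).mp hdeg w
    exact ⟨c, by rw [← hc, Algebra.smul_def, mul_one]⟩
  let e : ZMod p ≃+* 𝓞 F ⧸ P :=
    (Int.quotientSpanNatEquivZMod p).symm.trans (RingEquiv.ofBijective _ hbij)
  refine ⟨e.symm.toRingHom.comp (Ideal.Quotient.mk P), ?_⟩
  rw [RingHom.ker_equiv_comp, Ideal.mk_ker]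

theorem exists_isDegreeOnePrime_of_le {E : IntermediateField ℚ L} (h : E ≤ F)
    (hF : ∃ P, IsDegreeOnePrime p F P) : ∃ P, IsDegreeOnePrime p E P := by
  obtain ⟨P, hP⟩ := hF
  obtain ⟨φ, -⟩ := hP.exists_ringHom
  exact ⟨_, isDegreeOnePrime_ker (φ.comp (ringInclusion h))⟩

end DegreeOne

namespace UnramifiedTower

variable {ℓ p : ℕ} [Fact p.Prime] {t : ℤ} {L : Type*} [Field L] [CharZero L] {θ : ℕ → L}

theorem existsUnique_isDegreeOnePrime_levelInfty (hT : UnramifiedTower p ℓ t θ)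
    (ht : (t : ZMod p) ∈ Function.periodicPts (chebMap ℓ (ZMod p))) :
    ∃! P, IsDegreeOnePrime p (levelInfty θ) P := by
  obtain ⟨b, hb⟩ := exists_isBackwardOrbit ht
  obtain ⟨φ, -⟩ := hT.exists_ringHom_levelInfty (κ := ZMod p) hb
  refine ⟨_, isDegreeOnePrime_ker φ, fun P hP ↦ ?_⟩
  obtain ⟨ψ, rfl⟩ := hP.exists_ringHom
  have hψ := hT.isCompatible_apply_genInfty ψ
  have hφ := hT.isCompatible_apply_genInfty φ
  rw [hT.ringHom_levelInfty_ext (congrFun (hψ.isBackwardOrbit.eq_of_apply_zero_eq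
    hφ.isBackwardOrbit (hψ.1.trans hφ.1.symm)))]

theorem exists_isDegreeOnePrime_level (hT : UnramifiedTower p ℓ t θ)
    (ht : (t : ZMod p) ∈ Function.periodicPts (chebMap ℓ (ZMod p))) (n : ℕ) :
    ∃ P, IsDegreeOnePrime p (level θ n) P :=
  exists_isDegreeOnePrime_of_le (level_le_levelInfty θ n)
    (hT.existsUnique_isDegreeOnePrime_levelInfty ht).exists

end UnramifiedTower

section SignedPowers

theorem intUnits_eq_of_dvd_sub {N : ℕ} (hN : 3 ≤ N) {e e' : ℤˣ} (h : (N : ℤ) ∣ e - e') :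
    e = e' := by
  rcases Int.units_eq_one_or e with rfl | rfl <;> rcases Int.units_eq_one_or e' with rfl | rfl
  · rfl
  · exact absurd (Int.le_of_dvd (by norm_num) h) (by norm_num; lia)
  · exact absurd (Int.le_of_dvd (by norm_num) (dvd_neg.mpr h)) (by norm_num; lia)
  · rfl

theorem not_dvd_add_of_dvd_sub {N : ℕ} (hN : 3 ≤ N) {q : ℤ} {e : ℤˣ} (h : (N : ℤ) ∣ q - e) :
    ¬ (N : ℤ) ∣ q + e := by
  intro h'
  have : e = -e := intUnits_eq_of_dvd_sub hN (by simpa using dvd_sub h' h)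
  rcases Int.units_eq_one_or e with rfl | rfl <;> exact absurd this (by decide)

variable {ℓ w : ℕ} {q : ℤ} {e : ℤˣ}

theorem four_dvd_sub (h3 : 3 ≤ 2 ^ w) (hw : emultiplicity 2 (q - e) = w) : 4 ∣ q - e := by
  have hw2 : 2 ≤ w := by
    by_contra! hlt
    interval_cases w <;> norm_num at h3
  exact (pow_dvd_pow (2 : ℤ) hw2).trans (pow_dvd_of_le_emultiplicity hw.ge)

theorem eq_one_of_dvd_sub_of_dvd_add {d : ℕ} (hd : ¬ 2 ∣ d) (h : (d : ℤ) ∣ q - e)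
    (h' : (d : ℤ) ∣ q + e) : d = 1 := by
  have h2 : (d : ℤ) ∣ 2 * e := by simpa [two_mul] using dvd_sub h' h
  have h2 : d ∣ 2 := by exact_mod_cast (e.isUnit.dvd_mul_right).mp h2
  exact ((Nat.dvd_prime Nat.prime_two).mp h2).resolve_right fun h ↦ hd h.symm.dvd

theorem emultiplicity_pow_sub_intUnits_pow (hℓ : ℓ.Prime) (h3 : 3 ≤ ℓ ^ w)
    (hw : emultiplicity (ℓ : ℤ) (q - e) = w) (k : ℕ) :
    emultiplicity (ℓ : ℤ) (q ^ k - (e : ℤ) ^ k) = w + emultiplicity ℓ k := by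
  have hdvd : (ℓ : ℤ) ^ w ∣ q - e := pow_dvd_of_le_emultiplicity hw.ge
  have hw0 : w ≠ 0 := by rintro rfl; simp at h3
  have hℓq : (ℓ : ℤ) ∣ q - e := (dvd_pow_self _ hw0).trans hdvd
  have hnq : ¬ (ℓ : ℤ) ∣ q := fun hq ↦ (Nat.prime_iff_prime_int.mp hℓ).not_isUnit
    (isUnit_of_dvd_unit ((dvd_sub_right hq).mp hℓq) e.isUnit)
  rw [← hw]
  rcases hℓ.eq_two_or_odd' with rfl | hodd
  · rw [← Int.natCast_emultiplicity]
    exact Int.two_pow_sub_pow' k (four_dvd_sub h3 hw) hnq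
  · exact Int.emultiplicity_pow_sub_pow hℓ hodd hℓq hnq k

theorem emultiplicity_sq_sub_one (h3 : 3 ≤ 2 ^ w) (hw : emultiplicity 2 (q - e) = w) :
    emultiplicity 2 (q ^ 2 - 1) = (w + 1 : ℕ) := by
  have h := emultiplicity_pow_sub_intUnits_pow Nat.prime_two h3 hw 2
  rwa [← Units.val_pow_eq_pow_val, Int.units_sq, Nat.prime_two.emultiplicity_self,
    ← Nat.cast_succ] at h

theorem not_pow_dvd_pow_sub_intUnits (hℓ : ℓ.Prime) (h3 : 3 ≤ ℓ ^ w)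
    (hw : emultiplicity (ℓ : ℤ) (q - e) = w) {k m : ℕ} (hk : 0 < k) (hkm : k < ℓ ^ m) (δ : ℤˣ) :
    ¬ (ℓ : ℤ) ^ (w + m) ∣ q ^ k - δ := by
  intro h
  have hδ : e ^ k = δ := by
    refine intUnits_eq_of_dvd_sub h3 ?_
    push_cast
    have h1 : (ℓ : ℤ) ^ w ∣ q ^ k - (e : ℤ) ^ k :=
      (pow_dvd_of_le_emultiplicity hw.ge).trans (sub_dvd_pow_sub_pow q e k)
    simpa using dvd_sub ((pow_dvd_pow _ (Nat.le_add_right w m)).trans h) h1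
  rw [← hδ, Units.val_pow_eq_pow_val, pow_dvd_iff_le_emultiplicity,
    emultiplicity_pow_sub_intUnits_pow hℓ h3 hw, Nat.cast_add,
    ENat.add_le_add_iff_left (ENat.natCast_ne_top w), ← pow_dvd_iff_le_emultiplicity] at h
  exact hkm.not_ge (Nat.le_of_dvd hk h)

end SignedPowers

theorem orderOf_eq_mul_of_pow_pow_eq {G : Type*} [Monoid G] {ℓ n : ℕ} (hℓ : ℓ ≠ 0) {α γ : G}
    (h : γ ^ ℓ ^ n = α) (hα : ℓ ∣ orderOf α) : orderOf γ = ℓ ^ n * orderOf α := by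
  induction n generalizing γ with
  | zero => simp_all
  | succ n ih =>
    have h1 := ih (γ := γ ^ ℓ) (by rw [← pow_mul, ← pow_succ', h])
    have h2 : ℓ ∣ orderOf γ := (hα.trans (h1 ▸ Dvd.intro_left _ rfl)).trans (orderOf_pow_dvd ℓ)
    rw [orderOf_pow_of_dvd hℓ h2] at h1
    rw [← Nat.mul_div_cancel' h2, h1, pow_succ', mul_assoc]

section Valuations

variable {ℓ p : ℕ} [Fact ℓ.Prime] {hpℓ : p.Coprime ℓ} {e : ℤˣ}

theorem exists_four_dvd_sub {q : ℤ} (hq : Odd q) : ∃ e : ℤˣ, (4 : ℤ) ∣ q - e := by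
  obtain ⟨k, rfl⟩ := hq
  rcases Int.even_or_odd k with ⟨j, rfl⟩ | ⟨j, rfl⟩
  · exact ⟨1, j, by push_cast; ring⟩
  · exact ⟨-1, j + 1, by push_cast; ring⟩

theorem mu_eq_one (h : (ℓ : ℤ) ∣ p - e) : mu ℓ p hpℓ = 1 := by
  rw [mu, orderOf_eq_one_iff, QuotientGroup.eq_one_iff]
  have h1 : (p : ZMod ℓ) = ((e : ℤ) : ZMod ℓ) := by
    rw [← sub_eq_zero, ← Int.cast_natCast, ← Int.cast_sub, ZMod.intCast_zmod_eq_zero_iff_dvd]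
    exact h
  rcases Int.units_eq_one_or e with rfl | rfl
  · rw [(Units.ext (by simpa using h1) : ZMod.unitOfCoprime p hpℓ = 1)]
    exact one_mem _
  · rw [(Units.ext (by simpa using h1) : ZMod.unitOfCoprime p hpℓ = -1)]
    exact Subgroup.mem_zpowers _

variable [Fact p.Prime] {k : ℕ}

theorem D₁_eq_and_D₂_eq (h3 : 3 ≤ ℓ ^ k) (h : (ℓ : ℤ) ^ k ∣ p - e) :
    (D₁ ℓ p hpℓ : ℤ) = p - e ∧ (D₂ ℓ p hpℓ : ℤ) = p + e := by
  have h' : ¬ (ℓ : ℤ) ^ k ∣ p + e := by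
    rw [← Nat.cast_pow] at h ⊢
    exact not_dvd_add_of_dvd_sub h3 h
  have hk : k ≠ 0 := by rintro rfl; simp at h3
  have hp : 2 ≤ p := (Fact.out : p.Prime).two_le
  have hsub : ((p - 1 : ℕ) : ℤ) = p - 1 := Nat.cast_pred (by lia)
  have hadd : ((p + 1 : ℕ) : ℤ) = p + 1 := Nat.cast_succ p
  have hval {N : ℕ} (hN : N ≠ 0) : (ℓ : ℤ) ^ k ∣ N ↔ k ≤ padicValNat ℓ N := by
    rw [← padicValNat_dvd_iff_le hN]
    exact_mod_cast Iff.rfl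
  rw [D₁, D₂, mu_eq_one ((dvd_pow_self _ hk).trans h), pow_one]
  rcases Int.units_eq_one_or e with rfl | rfl
  · rw [Units.val_one, ← hsub, hval (by lia)] at h
    rw [Units.val_one, ← hadd, hval (by lia)] at h'
    rw [if_neg (by lia), if_neg (by lia)]
    exact ⟨hsub, hadd⟩
  · rw [Units.val_neg, Units.val_one, sub_neg_eq_add, ← hadd, hval (by lia)] at h
    rw [Units.val_neg, Units.val_one, ← sub_eq_add_neg, ← hsub, hval (by lia)] at h'
    rw [if_pos (by lia), if_pos (by lia)]
    exact ⟨by simp, by rw [hsub]; rfl⟩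

theorem emultiplicity_sub_eq_padicValNat_D₁ (h3 : 3 ≤ ℓ ^ k) (h : (ℓ : ℤ) ^ k ∣ p - e) :
    emultiplicity (ℓ : ℤ) (p - e) = padicValNat ℓ (D₁ ℓ p hpℓ) := by
  have hD := (D₁_eq_and_D₂_eq (hpℓ := hpℓ) h3 h).1
  have hp : 2 ≤ p := (Fact.out : p.Prime).two_le
  have h0 : D₁ ℓ p hpℓ ≠ 0 := by
    rintro h0
    rcases Int.units_eq_one_or e with rfl | rfl <;> simp [h0] at hD <;> lia
  rw [← hD, Int.natCast_emultiplicity, padicValNat_eq_emultiplicity h0]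

theorem three_le_pow_padicValNat_D₁ (h3 : 3 ≤ ℓ ^ k) (h : (ℓ : ℤ) ^ k ∣ p - e) :
    3 ≤ ℓ ^ padicValNat ℓ (D₁ ℓ p hpℓ) := by
  refine h3.trans (Nat.pow_le_pow_right (Fact.out : ℓ.Prime).pos (Nat.cast_le (α := ℕ∞).mp ?_))
  rw [← emultiplicity_sub_eq_padicValNat_D₁ h3 h]
  exact le_emultiplicity_of_pow_dvd h

end Valuations

theorem mem_periodicPts_of_preperiod_eq_zero {S : Type*} [Finite S] {φ : S → S} {a : S}
    (h : preperiod φ a = 0) : a ∈ Function.periodicPts φ := by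
  have hne : {r : ℕ | ∃ π : ℕ, 1 ≤ π ∧ φ^[r + π] a = φ^[r] a}.Nonempty := by
    obtain ⟨i, j, hij, heq⟩ := Finite.exists_ne_map_eq_of_infinite fun n ↦ φ^[n] a
    wlog hlt : i < j generalizing i j
    · exact this j i hij.symm heq.symm (by lia)
    exact ⟨i, j - i, by lia, by rw [Nat.add_sub_cancel' hlt.le]; exact heq.symm⟩
  obtain ⟨π, hπ, hper⟩ := Nat.sInf_mem hne
  rw [← preperiod, h, zero_add] at hper
  exact ⟨π, hπ, hper⟩

section Parameters

variable {κ : Type*} [Field κ] {ℓ p ρ d : ℕ} {t : ℤ} {α : κˣ}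

/-- `α` is a parameter of `t`: `t = α + α⁻¹` in `κ`, and `α` has order `ℓ ^ ρ * d` with `d` prime
to `ℓ`. In characteristic `p`, `ρ` is then the preperiod of `t` modulo `p`, and `d` corresponds to
the cycle that `t` is connected to. -/
structure IsParameter (ℓ : ℕ) (t : ℤ) (α : κˣ) (ρ d : ℕ) : Prop where
  addInv_eq : addInv α = (t : κ)
  orderOf_eq : orderOf α = ℓ ^ ρ * d
  not_dvd : ¬ ℓ ∣ d

theorem exists_pow_eq_of_chebMap_eq [IsAlgClosed κ] {n : ℕ} {b : κ}
    (hb : chebMap n κ b = addInv α) : ∃ γ : κˣ, γ ^ n = α ∧ addInv γ = b := by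
  obtain ⟨γ, rfl⟩ := addInv_surjective b
  rw [chebMap_addInv, addInv_eq_addInv_iff] at hb
  rcases hb with h | h
  · exact ⟨γ, h, rfl⟩
  · exact ⟨γ⁻¹, by rw [inv_pow, h, inv_inv], addInv_inv γ⟩

theorem addInv_pow_char_pow_eq_self_iff [Fact p.Prime] [CharP κ p] {r : ℕ} {u : κˣ} :
    addInv u ^ p ^ r = addInv u ↔ ∃ e : ℤˣ, (orderOf u : ℤ) ∣ (p : ℤ) ^ r - e := by
  rw [addInv_pow_char_pow]
  simpa using addInv_pow_eq_addInv_pow_iff (u := u) (m := p ^ r) (n := 1)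

theorem exists_orderOf_dvd_sub [Fact p.Prime] [CharP κ p] (hα : addInv α = (t : κ)) :
    ∃ e : ℤˣ, (orderOf α : ℤ) ∣ p - e := by
  have hfix : addInv α ^ p ^ 1 = addInv α := by
    rw [hα, pow_one, ← frobenius_def, map_intCast]
  simpa only [pow_one] using addInv_pow_char_pow_eq_self_iff.mp hfix

namespace IsParameter

theorem pow_dvd (hα : IsParameter ℓ t α ρ d) : (ℓ : ℤ) ^ ρ ∣ orderOf α := by
  rw [hα.orderOf_eq]
  exact_mod_cast dvd_mul_right _ d

theorem dvd (hα : IsParameter ℓ t α ρ d) : (d : ℤ) ∣ orderOf α := by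
  rw [hα.orderOf_eq]
  exact_mod_cast dvd_mul_left d _

theorem le_of_emultiplicity_eq (hα : IsParameter ℓ t α ρ d) {a : ℤ} {w : ℕ}
    (ha : (orderOf α : ℤ) ∣ a) (hw : emultiplicity (ℓ : ℤ) a = w) : ρ ≤ w :=
  Nat.cast_le.mp ((le_emultiplicity_of_pow_dvd (hα.pow_dvd.trans ha)).trans hw.le)

theorem castHom_iterate_chebMap [CharP κ p] (hα : IsParameter ℓ t α ρ d) (n : ℕ) :
    ZMod.castHom dvd_rfl κ ((chebMap ℓ (ZMod p))^[n] (t : ZMod p)) = addInv (α ^ ℓ ^ n) := by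
  rw [← chebMap_pow, map_chebMap, map_intCast, ← hα.addInv_eq, chebMap_addInv]

variable [Fact ℓ.Prime]

theorem orderOf_dvd_iff (hα : IsParameter ℓ t α ρ d) (n : ℕ) {a : ℤ} :
    ((ℓ ^ n * orderOf α : ℕ) : ℤ) ∣ a ↔ (ℓ : ℤ) ^ (n + ρ) ∣ a ∧ (d : ℤ) ∣ a := by
  have hcop : IsCoprime ((ℓ : ℤ) ^ (n + ρ)) d := by
    exact_mod_cast Nat.isCoprime_iff_coprime.mpr
      ((((Fact.out : ℓ.Prime).coprime_iff_not_dvd).mpr hα.not_dvd).pow_left (n + ρ))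
  rw [hα.orderOf_eq, ← mul_assoc, ← pow_add]
  push_cast
  exact ⟨fun h ↦ ⟨(dvd_mul_right _ _).trans h, (dvd_mul_left _ _).trans h⟩,
    fun h ↦ hcop.mul_dvd h.1 h.2⟩

section Frobenius

variable [IsAlgClosed κ] [Fact p.Prime] [CharP κ p] {n r w : ℕ} {e : ℤˣ} {b : κ}

theorem pow_eq_self_iff (hα : IsParameter ℓ t α ρ d) (hρ : 0 < ρ)
    (hb : chebMap (ℓ ^ n) κ b = t) :
    b ^ p ^ r = b ↔
      ∃ e : ℤˣ, (ℓ : ℤ) ^ (n + ρ) ∣ (p : ℤ) ^ r - e ∧ (d : ℤ) ∣ (p : ℤ) ^ r - e := by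
  obtain ⟨γ, hγ, rfl⟩ := exists_pow_eq_of_chebMap_eq (hb.trans hα.addInv_eq.symm)
  have hℓα : ℓ ∣ orderOf α := hα.orderOf_eq ▸ (dvd_pow_self ℓ hρ.ne').mul_right d
  simp only [addInv_pow_char_pow_eq_self_iff, ← hα.orderOf_dvd_iff,
    orderOf_eq_mul_of_pow_pow_eq (Fact.out : ℓ.Prime).ne_zero hγ hℓα]

theorem pow_eq_self (hα : IsParameter ℓ t α ρ d) (hρ : 0 < ρ)
    (he : (orderOf α : ℤ) ∣ (p : ℤ) ^ r - e)
    (hw : emultiplicity (ℓ : ℤ) ((p : ℤ) ^ r - e) = w) (hn : n + ρ ≤ w)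
    (hb : chebMap (ℓ ^ n) κ b = t) : b ^ p ^ r = b :=
  (hα.pow_eq_self_iff hρ hb).mpr
    ⟨e, pow_dvd_of_le_emultiplicity (hw ▸ Nat.cast_le.mpr hn), hα.dvd.trans he⟩

theorem pow_pow_ne_self (hα : IsParameter ℓ t α ρ d) (hρ : 0 < ρ) (h3 : 3 ≤ ℓ ^ w)
    (hw : emultiplicity (ℓ : ℤ) ((p : ℤ) ^ r - e) = w) {m k : ℕ} (hn : n + ρ = w + m)
    (hb : chebMap (ℓ ^ n) κ b = t) (hk : 0 < k) (hkm : k < ℓ ^ m) : b ^ (p ^ r) ^ k ≠ b := by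
  rw [← pow_mul, Ne, hα.pow_eq_self_iff hρ hb, hn, pow_mul]
  rintro ⟨δ, hδ, -⟩
  exact not_pow_dvd_pow_sub_intUnits Fact.out h3 hw hk hkm δ hδ

end Frobenius

section Preperiod

variable [Fact p.Prime] [CharP κ p]

theorem exists_iterate_eq_iff_le (hα : IsParameter ℓ t α ρ d) (r : ℕ) :
    (∃ s, 1 ≤ s ∧ (chebMap ℓ (ZMod p))^[r + s] (t : ZMod p) =
      (chebMap ℓ (ZMod p))^[r] (t : ZMod p)) ↔ ρ ≤ r := by
  have hℓ : ℓ.Prime := Fact.out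
  have hℓ' : Prime (ℓ : ℤ) := Nat.prime_iff_prime_int.mp hℓ
  have hfactor (s : ℕ) (e : ℤ) : ((ℓ ^ (r + s) : ℕ) : ℤ) - e * (ℓ ^ r : ℕ) =
      (ℓ : ℤ) ^ r * ((ℓ : ℤ) ^ s - e) := by
    push_cast
    ring
  simp only [← (ZMod.castHom (dvd_refl p) κ).injective.eq_iff, hα.castHom_iterate_chebMap,
    addInv_pow_eq_addInv_pow_iff, hfactor]
  constructor
  · rintro ⟨s, hs, e, h⟩
    have hndvd : ¬ (ℓ : ℤ) ∣ (ℓ : ℤ) ^ s - e := fun h' ↦ hℓ'.not_isUnit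
      (isUnit_of_dvd_unit ((dvd_sub_right (dvd_pow_self _ (by lia))).mp h') e.isUnit)
    refine (pow_dvd_pow_iff hℓ'.ne_zero hℓ'.not_isUnit).mp ?_
    exact ((hℓ'.coprime_iff_not_dvd.mpr hndvd).pow_left).dvd_of_dvd_mul_right
      (hα.pow_dvd.trans h)
  · intro hρr
    have hd : 0 < d := Nat.pos_of_ne_zero (by rintro rfl; exact hα.not_dvd (dvd_zero ℓ))
    have heuler : (d : ℤ) ∣ (ℓ : ℤ) ^ d.totient - 1 := by
      simpa using Nat.modEq_iff_dvd.mp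
        (Nat.ModEq.pow_totient ((hℓ.coprime_iff_not_dvd).mpr hα.not_dvd)).symm
    refine ⟨d.totient, Nat.totient_pos.mpr hd, 1, ?_⟩
    rw [hα.orderOf_eq]
    push_cast
    exact mul_dvd_mul (pow_dvd_pow _ hρr) heuler

theorem preperiod_eq (hα : IsParameter ℓ t α ρ d) :
    preperiod (chebMap ℓ (ZMod p)) (t : ZMod p) = ρ := by
  simp only [preperiod, hα.exists_iterate_eq_iff_le]
  exact csInf_Ici

theorem eq_of_connectedToCycle [IsAlgClosed κ] (hα : IsParameter ℓ t α ρ d) {d' : ℕ}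
    (h : ConnectedToCycle ℓ p (t : ZMod p) d') : d' = d := by
  have hℓ : ℓ.Prime := Fact.out
  obtain ⟨k, ⟨s, hs, hper⟩, β, hβ, rfl⟩ := h
  have hρk : ρ ≤ k := (hα.exists_iterate_eq_iff_le (p := p) k).mp
    ⟨s, hs, by rw [add_comm, Function.iterate_add_apply]; exact hper⟩
  have hpow : orderOf (α ^ ℓ ^ k) = d := by
    have hρ : orderOf (α ^ ℓ ^ ρ) = d := by
      rw [orderOf_pow_of_dvd (pow_ne_zero _ hℓ.ne_zero) (hα.orderOf_eq ▸ dvd_mul_right _ d),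
        hα.orderOf_eq, Nat.mul_div_cancel_left _ (pow_pos hℓ.pos _)]
    rw [← Nat.add_sub_cancel' hρk, pow_add, pow_mul, Nat.Coprime.orderOf_pow, hρ]
    exact hρ ▸ (((hℓ.coprime_iff_not_dvd).mpr hα.not_dvd).pow_left _).symm
  let := ZMod.algebra κ p
  let φ : GaloisField p 2 →+* κ := (IsAlgClosed.lift : GaloisField p 2 →ₐ[ZMod p] κ).toRingHom
  have hord : orderOf (Units.map (φ : GaloisField p 2 →* κ) β) = orderOf β :=
    orderOf_injective _ (Units.map_injective φ.injective) β
  have hsum : addInv (Units.map (φ : GaloisField p 2 →* κ) β) = addInv (α ^ ℓ ^ k) := by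
    rw [← hα.castHom_iterate_chebMap (p := p), ← map_addInv, addInv, ← hβ,
      ← RingHom.ext_zmod (φ.comp (algebraMap (ZMod p) _)) (ZMod.castHom dvd_rfl κ),
      RingHom.comp_apply]
  rw [← hord, ← hpow]
  rcases addInv_eq_addInv_iff.mp hsum with h | h
  · rw [h]
  · rw [h, orderOf_inv]

end Preperiod

end IsParameter

variable (κ ℓ p t) in
theorem exists_isParameter [IsAlgClosed κ] [Fact ℓ.Prime] [Fact p.Prime] [CharP κ p] :
    ∃ (α : κˣ) (d : ℕ),
      IsParameter ℓ t α (preperiod (chebMap ℓ (ZMod p)) (t : ZMod p)) d := by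
  obtain ⟨α, hα⟩ := addInv_surjective (t : κ)
  have hord : orderOf α ≠ 0 := by
    intro h0
    obtain ⟨e, he⟩ := exists_orderOf_dvd_sub (p := p) hα
    have hpe : (p : ℤ) = e := by simpa [h0, sub_eq_zero] using he
    exact (Nat.prime_iff_prime_int.mp (Fact.out : p.Prime)).not_isUnit (hpe ▸ e.isUnit)
  obtain ⟨ρ, d, hd, hρ⟩ := Nat.exists_eq_pow_mul_and_not_dvd hord ℓ (Fact.out : ℓ.Prime).ne_one
  have hpar : IsParameter ℓ t α ρ d := ⟨hα, hρ, hd⟩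
  exact ⟨α, d, hpar.preperiod_eq (p := p) ▸ hpar⟩

end Parameters

namespace IsParameter

variable {κ : Type*} [Field κ] {ρ d : ℕ} {t : ℤ} {α : κˣ} {e : ℤˣ}

theorem le_one_of_dvd_add (hα : IsParameter 2 t α ρ d) {q : ℤ} (h4 : 4 ∣ q - e)
    (hord : (orderOf α : ℤ) ∣ q + e) : ρ ≤ 1 := by
  by_contra! hlt
  exact not_dvd_add_of_dvd_sub (N := 4) (by norm_num) h4
    ((pow_dvd_pow (2 : ℤ) hlt).trans (hα.pow_dvd.trans hord))

variable {p : ℕ} [Fact p.Prime] [CharP κ p]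

theorem orderOf_dvd_sub_or_dvd_add {ℓ : ℕ} (hα : IsParameter ℓ t α ρ d) (e : ℤˣ) :
    (orderOf α : ℤ) ∣ p - e ∨ (orderOf α : ℤ) ∣ p + e := by
  obtain ⟨ε, hε⟩ := exists_orderOf_dvd_sub (p := p) hα.addInv_eq
  rcases Int.units_eq_one_or e with rfl | rfl <;> rcases Int.units_eq_one_or ε with rfl | rfl
  exacts [.inl hε, .inr (by simpa using hε), .inr hε, .inl hε]

theorem orderOf_dvd_sub_of_dvd (hα : IsParameter 2 t α ρ d) (h4 : (4 : ℤ) ∣ p - e)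
    (hd : (d : ℤ) ∣ p - e) : (orderOf α : ℤ) ∣ p - e := by
  refine (hα.orderOf_dvd_sub_or_dvd_add e).elim id fun hord ↦ ?_
  have h2 : (2 : ℤ) ^ ρ ∣ p - e := (pow_dvd_pow 2 (hα.le_one_of_dvd_add h4 hord)).trans
    (dvd_trans (by norm_num) h4)
  simpa using (hα.orderOf_dvd_iff 0).mpr ⟨by simpa using h2, hd⟩

theorem orderOf_dvd_add_of_dvd (hα : IsParameter 2 t α ρ d) (hd1 : d ≠ 1)
    (hd : (d : ℤ) ∣ p + e) : (orderOf α : ℤ) ∣ p + e :=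
  (hα.orderOf_dvd_sub_or_dvd_add e).resolve_left fun hord ↦
    hd1 (eq_one_of_dvd_sub_of_dvd_add hα.not_dvd (hα.dvd.trans hord) hd)

theorem pow_ne_self_of_dvd_add [IsAlgClosed κ] (hα : IsParameter 2 t α ρ d) (hρ : 0 < ρ)
    (hd1 : d ≠ 1) (h4 : (4 : ℤ) ∣ p - e) (hd : (d : ℤ) ∣ p + e) {b : κ}
    (hb : chebMap (2 ^ 1) κ b = t) : b ^ p ≠ b := by
  intro hfix
  obtain ⟨δ, h2δ, hdδ⟩ := (hα.pow_eq_self_iff (r := 1) hρ hb).mp (by simpa using hfix)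
  rw [pow_one] at h2δ hdδ
  have h4δ : (4 : ℤ) ∣ p - δ := (pow_dvd_pow (2 : ℤ) (by lia : 2 ≤ 1 + ρ)).trans h2δ
  obtain rfl : δ = e := intUnits_eq_of_dvd_sub (N := 4) (by norm_num)
    (by simpa using dvd_sub h4 h4δ)
  exact hd1 (eq_one_of_dvd_sub_of_dvd_add hα.not_dvd hdδ hd)

end IsParameter

namespace UnramifiedTower

variable {ℓ p : ℕ} [Fact ℓ.Prime] [Fact p.Prime] {t : ℤ} {L : Type*} [Field L] [CharZero L]
  {θ : ℕ → L} {κ : Type*} [Field κ] [CharP κ p] [IsAlgClosed κ] {α : κˣ} {ρ d v : ℕ} {e : ℤˣ}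

theorem inertAbove_of_emultiplicity_eq (hT : UnramifiedTower p ℓ t θ)
    (hα : IsParameter ℓ t α ρ d) (hρ : 0 < ρ) {r w : ℕ} (hord : (orderOf α : ℤ) ∣ (p : ℤ) ^ r - e)
    (h3 : 3 ≤ ℓ ^ w) (hw : emultiplicity (ℓ : ℤ) ((p : ℤ) ^ r - e) = w) {n : ℕ}
    (hn : w - ρ ≤ n) : InertAbove p (level θ (w - ρ)) (level θ n) := by
  have hρw : ρ ≤ w := hα.le_of_emultiplicity_eq hord hw
  exact hT.inertAbove κ hn (fun _ hc ↦ hα.pow_eq_self hρ hord hw (by lia) hc)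
    fun _ hb _ hk hkn ↦ hα.pow_pow_ne_self hρ h3 hw (by lia) hb hk hkn

theorem splits_then_inert (hT : UnramifiedTower p ℓ t θ) (hα : IsParameter ℓ t α ρ d)
    (hρ : 0 < ρ) (h3 : 3 ≤ ℓ ^ v) (hv : emultiplicity (ℓ : ℤ) (p - e) = v)
    (hord : (orderOf α : ℤ) ∣ p - e) :
    ρ ≤ v ∧ (∀ n, 1 ≤ n → n ≤ v - ρ → SplitsCompletely p (level θ n)) ∧
      ∀ n, v - ρ ≤ n → InertAbove p (level θ (v - ρ)) (level θ n) := by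
  have hρv : ρ ≤ v := hα.le_of_emultiplicity_eq hord hv
  rw [← pow_one (p : ℤ)] at hv hord
  refine ⟨hρv, fun n _ hn ↦ hT.splitsCompletely κ n fun b hb ↦ ?_,
    fun n hn ↦ hT.inertAbove_of_emultiplicity_eq hα hρ hord h3 hv hn⟩
  simpa using hα.pow_eq_self hρ hord hv (by lia) hb

theorem inert_then_splits_then_inert (hT : UnramifiedTower p 2 t θ)
    (hα : IsParameter 2 t α ρ d) (hρ : 0 < ρ) (hd1 : d ≠ 1) (h3 : 3 ≤ 2 ^ v)
    (hv : emultiplicity 2 (p - e : ℤ) = v) (hd : (d : ℤ) ∣ p + e) :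
    ρ ≤ v ∧ Inert p (level θ 1) ∧
      (∀ n, 2 ≤ n → n ≤ v - ρ + 1 → SplitsCompletelyAbove p (level θ 1) (level θ n)) ∧
      ∀ n, v - ρ + 1 ≤ n → InertAbove p (level θ (v - ρ + 1)) (level θ n) := by
  have h4 := four_dvd_sub h3 hv
  have hord := hα.orderOf_dvd_add_of_dvd hd1 hd
  obtain rfl : ρ = 1 := le_antisymm (hα.le_one_of_dvd_add h4 hord) hρ
  have hv1 : 1 ≤ v := Nat.one_le_iff_ne_zero.mpr (by rintro rfl; simp at h3)
  have hw : emultiplicity ((2 : ℕ) : ℤ) ((p : ℤ) ^ 2 - (1 : ℤˣ)) = (v + 1 : ℕ) :=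
    emultiplicity_sq_sub_one h3 hv
  have hord2 : (orderOf α : ℤ) ∣ (p : ℤ) ^ 2 - (1 : ℤˣ) := by
    have hfactor : (p : ℤ) ^ 2 - (1 : ℤˣ) = (p + e) * (p - e) := by
      rw [← sq_sub_sq, ← Units.val_pow_eq_pow_val, Int.units_sq]
    exact hfactor ▸ hord.mul_right _
  have hfix (n : ℕ) (hn : n ≤ v) (b : κ) (hb : chebMap (2 ^ n) κ b = t) : b ^ p ^ 2 = b :=
    hα.pow_eq_self hρ hord2 hw (by lia) hb
  have hne (b : κ) (hb : chebMap (2 ^ 1) κ b = t) : b ^ p ≠ b :=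
    hα.pow_ne_self_of_dvd_add hρ hd1 h4 hd hb
  refine ⟨hv1, hT.inert κ 1 fun b hb k hk hk2 ↦ ?_, fun n hn hnv ↦ ?_, fun n hn ↦ ?_⟩
  · obtain rfl : k = 1 := by lia
    simpa using hne b hb
  · exact hT.splitsCompletelyAbove κ (by lia) hne (hfix n (by lia))
  · rw [← Nat.sub_add_comm hv1] at hn ⊢
    exact hT.inertAbove_of_emultiplicity_eq hα hρ hord2
      (h3.trans (Nat.pow_le_pow_right two_pos v.le_succ)) hw hn

end UnramifiedTower

end ChebTower

end

theorem corollary3p5 (ℓ p : ℕ) [Fact ℓ.Prime] [Fact p.Prime] (hpℓ : p.Coprime ℓ) (t : ℤ)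
    (hirr : ∀ n : ℕ, 1 ≤ n → Irreducible (ChebTower.chebIter ℓ ℤ n - Polynomial.C t))
    (hp : ¬ (p : ℤ) ∣ (ℓ : ℤ) * (4 - t ^ 2))
    {L : Type*} [Field L] [CharZero L] (θ : ℕ → L) (hθ : ChebTower.IsCompatible ℓ t θ)
    (v ρ : ℕ) (hv : v = padicValNat ℓ (ChebTower.D₁ ℓ p hpℓ))
    (hρ : ρ = ChebTower.preperiod (ChebTower.chebMap ℓ (ZMod p)) (t : ZMod p)) :
    -- Case 1: `ℓ` is odd.
    (Odd ℓ →
      (0 < ρ →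
        ρ ≤ v ∧
        (∀ n : ℕ, 1 ≤ n → n ≤ v - ρ → ChebTower.SplitsCompletely p (ChebTower.level θ n)) ∧
        (∀ n : ℕ, v - ρ ≤ n →
          ChebTower.InertAbove p (ChebTower.level θ (v - ρ)) (ChebTower.level θ n))) ∧
      (ρ = 0 →
        (∀ n : ℕ, ∃ P, ChebTower.IsDegreeOnePrime p (ChebTower.level θ n) P) ∧
        (∃! P, ChebTower.IsDegreeOnePrime p (ChebTower.levelInfty θ) P))) ∧
    -- Case 2: `ℓ = 2`.
    (ℓ = 2 →
      (∀ d : ℕ, 0 < ρ → ChebTower.ConnectedToCycle ℓ p (t : ZMod p) d →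
        d ∣ ChebTower.D₁ ℓ p hpℓ →
        ρ ≤ v ∧
        (∀ n : ℕ, 1 ≤ n → n ≤ v - ρ → ChebTower.SplitsCompletely p (ChebTower.level θ n)) ∧
        (∀ n : ℕ, v - ρ ≤ n →
          ChebTower.InertAbove p (ChebTower.level θ (v - ρ)) (ChebTower.level θ n))) ∧
      -- `d = 1` is the fixed point `2`; as `1` divides both numbers, it belongs to `D₁` above.
      (∀ d : ℕ, 0 < ρ → ChebTower.ConnectedToCycle ℓ p (t : ZMod p) d →
        d ∣ ChebTower.D₂ ℓ p hpℓ → d ≠ 1 →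
        ρ ≤ v ∧
        ChebTower.Inert p (ChebTower.level θ 1) ∧
        (∀ n : ℕ, 2 ≤ n → n ≤ v - ρ + 1 →
          ChebTower.SplitsCompletelyAbove p (ChebTower.level θ 1) (ChebTower.level θ n)) ∧
        (∀ n : ℕ, v - ρ + 1 ≤ n →
          ChebTower.InertAbove p (ChebTower.level θ (v - ρ + 1)) (ChebTower.level θ n))) ∧
      (ρ = 0 →
        (∀ n : ℕ, ∃ P, ChebTower.IsDegreeOnePrime p (ChebTower.level θ n) P) ∧
        (∃! P, ChebTower.IsDegreeOnePrime p (ChebTower.levelInfty θ) P))) := by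
  have hT := ChebTower.UnramifiedTower.of_irreducible_chebIter hθ hirr hp
  obtain ⟨α, d₀, hα⟩ := ChebTower.exists_isParameter (AlgebraicClosure (ZMod p)) ℓ p t
  rw [← hρ] at hα
  have ht (h0 : ρ = 0) : (t : ZMod p) ∈ (ChebTower.chebMap ℓ (ZMod p)).periodicPts :=
    ChebTower.mem_periodicPts_of_preperiod_eq_zero (hρ ▸ h0)
  have hdegree (h0 : ρ = 0) := And.intro (hT.exists_isDegreeOnePrime_level (ht h0))
    (hT.existsUnique_isDegreeOnePrime_levelInfty (ht h0))
  subst hv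
  refine ⟨fun hodd ↦ ⟨fun h0 ↦ ?_, hdegree⟩, fun h2 ↦ ?_⟩
  · obtain ⟨e, he⟩ := ChebTower.exists_orderOf_dvd_sub (p := p) hα.addInv_eq
    have h3 : 3 ≤ ℓ ^ 1 := by grind [(Fact.out : ℓ.Prime).two_le]
    have hℓe : (ℓ : ℤ) ^ 1 ∣ p - e := (pow_dvd_pow _ h0).trans (hα.pow_dvd.trans he)
    exact hT.splits_then_inert hα h0 (ChebTower.three_le_pow_padicValNat_D₁ h3 hℓe)
      (ChebTower.emultiplicity_sub_eq_padicValNat_D₁ h3 hℓe) he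
  · subst h2
    obtain ⟨e, he⟩ := ChebTower.exists_four_dvd_sub (q := p)
      (by exact_mod_cast Nat.coprime_two_right.mp hpℓ)
    have h4 : 3 ≤ 2 ^ 2 := by norm_num
    have h3 := ChebTower.three_le_pow_padicValNat_D₁ (hpℓ := hpℓ) h4 he
    have hv := ChebTower.emultiplicity_sub_eq_padicValNat_D₁ (hpℓ := hpℓ) h4 he
    obtain ⟨hD₁, hD₂⟩ := ChebTower.D₁_eq_and_D₂_eq (hpℓ := hpℓ) h4 he
    refine ⟨fun d h0 hcon hd ↦ ?_, fun d h0 hcon hd hd1 ↦ ?_, hdegree⟩ <;>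
      obtain rfl := hα.eq_of_connectedToCycle hcon
    · rw [← Int.natCast_dvd_natCast, hD₁] at hd
      exact hT.splits_then_inert hα h0 h3 hv (hα.orderOf_dvd_sub_of_dvd he hd)
    · rw [← Int.natCast_dvd_natCast, hD₂] at hd
      exact hT.inert_then_splits_then_inert hα h0 hd1 h3 hv hd
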